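/- **Conventions.** A monoid is a commutative monoid with an absorbing element $0$; monoid morphisms preserve $0$ and $1$. A *blueprint* $B=A/\!/\mathcal R$ is a monoid $A$ together with an equivalence relation $\equiv$ on the semiring $\mathbb N[A]$ of finite formal sums of elements of $A$ that is compatible with sums and products, identifies $0\in A$ with the empty sum, and satisfies $a=b$ whenever $a\equiv b$ with $a,b\in A$. Morphisms of blueprints are monoid morphisms that preserve all additive relations $\sum a_i\equiv\sum b_j$. A *blue field* is a blueprint whose units are exactly its non-zero elements. For a monoid $M$, the *monoid blueprint* $B[M]$ is the smash product $A\wedge M$ (the quotient of $A\times M$ identifying all pairs with a zero coordinate) with the relation $\equiv$ generated by the relations $\sum a_i\wedge 1\equiv\sum b_j\wedge 1$ for which $\sum a_i\equiv\sum b_j$ in $B$. The localization $S^{-1}B$ at a multiplicative subset $S$ is $S^{-1}A$ with the relation $\equiv$ generated by the images of the relations of $B$. An *ideal* of $B$ is a subset $I$ with $0\in I$ and $IB\subseteq I$ such that $c\in I$ whenever $\sum a_i+c\equiv\sum b_j$ with all $a_i,b_j\in I$; it is *prime* if its complement is a multiplicative subset. $\operatorname{Spec}B$ is the set of prime ideals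 with the topology generated by the sets $\{\mathfrak p : h\notin\mathfrak p\}$, and with the sheaf of blueprints whose sections over $U$ are the families in $\prod_{\mathfrak p\in U}B_{\mathfrak p}$ that are locally given by fractions $a/f$, an additive relation holding between sections if it holds in every $B_{\mathfrak p}$. A *blue scheme* is a topological space with a sheaf of blueprints that is covered by open subspaces isomorphic to spectra of blueprints; a blue scheme over $B$ is a blue scheme $X$ with a morphism $X\to\operatorname{Spec}B$, equivalently a morphism of blueprints $B\to\Gamma(X,\mathcal O_X)$. A *monoidal scheme over $B$* is a blue scheme $X$ over $B$ with an open covering $\{U_i\}$ such that 1. for every $i$ there are a monoid $M_i$ and an isomorphism $U_i\simeq\operatorname{Spec}B[M_i]$ over $B$; 2. for all $i,j$ the intersection $U_i\cap U_j$ is covered by open subsets $V_{i,j,k}\simeq\operatorname{Spec}B[N_{i,j,k}]$ (over $B$), for monoids $N_{i,j,k}$, such that the restriction maps $B[M_i]\to B[N_{i,j,k}]$ and $B[M_j]\to B[N_{i,j,k}]$ are induced by monoid morphisms $M_i\to N_{i,j,k}$ and $M_j\to N_{i,j,k}$ that are localizations at multiplicative subsets of $M_i$ and of $M_j$, respectively.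 **Proposition.** Let $B$ be a blue field and let $X$ be a monoidal scheme over $B$. Then every open subset $U$ of $X$ has an open covering $\{W_i\}$ such that, for every $i$, there are a monoid $M_i$ and an isomorphism $W_i\simeq\operatorname{Spec}B[M_i]$ over $B$. -/

import Mathlib

open CategoryTheory TopologicalSpace Opposite AlgebraicGeometry

universe u

noncomputable section

/-! ### Blueprints -/

/-- The semiring `ℕ[A]` of finite formal sums of elements of `A`
(the zero of `A` is not identified with the empty sum). -/
abbrev FormalSum (A : Type u) [CommMonoidWithZero A] : Type u := MonoidAlgebra ℕ A

namespace FormalSum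

/-- The formal sum consisting of the single summand `a`. -/
def of {A : Type u} [CommMonoidWithZero A] : A →* FormalSum A := MonoidAlgebra.of ℕ A

/-- The map on formal sums induced by a morphism of monoids (with zero): `∑ aᵢ ↦ ∑ f aᵢ`. -/
def map {A C : Type u} [CommMonoidWithZero A] [CommMonoidWithZero C] (f : A →*₀ C) :
    FormalSum A →+* FormalSum C :=
  MonoidAlgebra.mapDomainRingHom ℕ (f : A →* C)

variable {A C D : Type u} [CommMonoidWithZero A] [CommMonoidWithZero C] [CommMonoidWithZero D]

@[simp] lemma map_of (f : A →*₀ C) (a : A) : map f (of a) = of (f a) := by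
  simp [map, of]

@[simp] lemma map_id (x : FormalSum A) : map (MonoidWithZeroHom.id A) x = x := by
  have : (MonoidWithZeroHom.id A : A →* A) = MonoidHom.id A := rfl
  simp [map, this]

lemma map_comp (g : C →*₀ D) (f : A →*₀ C) (x : FormalSum A) :
    map (g.comp f) x = map g (map f x) := by
  have : (g.comp f : A →* D) = (g : C →* D).comp (f : A →* C) := rfl
  simp [map, this, MonoidAlgebra.mapDomainRingHom_comp]

/-- Extension of a multiplicative map to formal sums: `∑ aᵢ ↦ ∑ f aᵢ`, evaluated in a semiring. -/
def eval {R : Type*} [CommSemiring R] (f : A →* R) : FormalSum A →+* R :=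
  (MonoidAlgebra.lift ℕ R A f : MonoidAlgebra ℕ A →+* R)

@[simp] lemma eval_of {R : Type*} [CommSemiring R] (f : A →* R) (a : A) :
    eval f (of a) = f a := by
  simp [eval, of]

lemma eval_map {R : Type*} [CommSemiring R] (f : C →* R) (g : A →*₀ C) (x : FormalSum A) :
    eval f (map g x) = eval (f.comp (g : A →* C)) x := by
  have : (eval f).comp (map g) = eval (f.comp (g : A →* C)) := by
    apply MonoidAlgebra.ringHom_ext
    · intro r; simp [eval, map]
    · intro a; simp [eval, map]
  exact DFunLike.congr_fun this x

lemma comp_eval {R S : Type*} [CommSemiring R] [CommSemiring S] (h : R →+* S) (f : A →* R)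
    (x : FormalSum A) : h (eval f x) = eval ((h : R →* S).comp f) x := by
  have : h.comp (eval f) = eval ((h : R →* S).comp f) := by
    apply MonoidAlgebra.ringHom_ext
    · intro r; simp [eval]
    · intro a; simp [eval]
  exact DFunLike.congr_fun this x

end FormalSum

/-- The quotient of a semiring by a congruence. -/
def ConQuotient {R : Type u} [CommSemiring R] (c : RingCon R) : Type u := c.Quotient

namespace ConQuotient

variable {R : Type u} [CommSemiring R] (c : RingCon R)

instance : CommSemiring (ConQuotient c) := inferInstanceAs (CommSemiring c.Quotient)

/-- The quotient map. -/
def mk : R →+* ConQuotient c where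
  toFun x := (x : c.Quotient)
  map_zero' := rfl
  map_one' := rfl
  map_add' _ _ := rfl
  map_mul' _ _ := rfl

lemma mk_eq_iff {x y : R} : mk c x = mk c y ↔ c x y := c.eq

end ConQuotient

/-- A blueprint `B = A // R`: a commutative monoid `A` with zero together with a pre-addition `R`,
that is, an equivalence relation on `ℕ[A]` which is additive and multiplicative, which identifies
the zero of `A` with the empty sum, and for which `a ≡ b` implies `a = b` for `a, b ∈ A`. -/
structure Blueprint : Type (u + 1) where
  /-- the underlying monoid -/
  carrier : Type u
  [monoid : CommMonoidWithZero carrier]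
  /-- the pre-addition -/
  rel : RingCon (FormalSum carrier)
  rel_zero : rel (FormalSum.of 0) 0
  eq_of_rel : ∀ a b : carrier, rel (FormalSum.of a) (FormalSum.of b) → a = b

namespace Blueprint

instance : CoeSort Blueprint.{u} (Type u) := ⟨Blueprint.carrier⟩

instance (B : Blueprint.{u}) : CommMonoidWithZero B := B.monoid

/-- A morphism of blueprints: a morphism of monoids with zero that preserves additive relations. -/
@[ext]
structure Hom (B C : Blueprint.{u}) : Type u where
  /-- the underlying morphism of monoids -/
  toMonoidHom : B →*₀ C
  map_rel : ∀ x y : FormalSum B, B.rel x y →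
    C.rel (FormalSum.map toMonoidHom x) (FormalSum.map toMonoidHom y)

/-- The category of blueprints. -/
instance : Category Blueprint.{u} where
  Hom := Hom
  id B := ⟨MonoidWithZeroHom.id B, fun x y h => by simpa using h⟩
  comp f g := ⟨g.toMonoidHom.comp f.toMonoidHom, fun x y h => by
    simpa only [FormalSum.map_comp] using g.map_rel _ _ (f.map_rel _ _ h)⟩

lemma hom_ext {B C : Blueprint.{u}} {f g : B ⟶ C}
    (h : ∀ b : B, f.toMonoidHom b = g.toMonoidHom b) : f = g :=
  Hom.ext (MonoidWithZeroHom.ext h)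

@[simp] lemma comp_apply {B C D : Blueprint.{u}} (f : B ⟶ C) (g : C ⟶ D) (b : B) :
    (f ≫ g).toMonoidHom b = g.toMonoidHom (f.toMonoidHom b) := rfl

@[simp] lemma id_apply {B : Blueprint.{u}} (b : B) : (𝟙 B : B ⟶ B).toMonoidHom b = b := rfl

/-- A blue field: a blueprint whose units are exactly its non-zero elements. -/
def IsBlueField (B : Blueprint.{u}) : Prop := ∀ b : B, IsUnit b ↔ b ≠ 0

/-- The multiplicative map from `B` to the semiring `ℕ[A]/R`. -/
def toSemiring (B : Blueprint.{u}) : B →* ConQuotient B.rel :=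
  (ConQuotient.mk B.rel : FormalSum B →* ConQuotient B.rel).comp FormalSum.of

lemma toSemiring_zero (B : Blueprint.{u}) : B.toSemiring 0 = 0 :=
  ((ConQuotient.mk_eq_iff B.rel).mpr B.rel_zero).trans (map_zero _)

lemma toSemiring_injective (B : Blueprint.{u}) : Function.Injective B.toSemiring := by
  intro a b h
  exact B.eq_of_rel a b ((ConQuotient.mk_eq_iff B.rel).mp h)

lemma eval_toSemiring (B : Blueprint.{u}) (x : FormalSum B) :
    FormalSum.eval B.toSemiring x = ConQuotient.mk B.rel x := by
  have : FormalSum.eval B.toSemiring = ConQuotient.mk B.rel := by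
    apply MonoidAlgebra.ringHom_ext
    · intro r
      have h1 : (MonoidAlgebra.single (1 : B) r : MonoidAlgebra ℕ B) = (r : MonoidAlgebra ℕ B) := by
        simp [MonoidAlgebra.natCast_def]
      rw [h1, map_natCast, map_natCast]
    · intro a
      exact FormalSum.eval_of _ _
  exact DFunLike.congr_fun this x

lemma eval_toSemiring_eq (B : Blueprint.{u}) {x y : FormalSum B} (h : B.rel x y) :
    FormalSum.eval B.toSemiring x = FormalSum.eval B.toSemiring y := by
  rw [eval_toSemiring, eval_toSemiring]
  exact (ConQuotient.mk_eq_iff B.rel).mpr h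

/-! ### Localizations -/

section Localization

variable (B : Blueprint.{u}) (S : Submonoid B)

/-- The map `a ↦ a / 1` from the monoid `A` to its localization `S⁻¹A`. -/
def localizationMap : B →*₀ Localization S where
  toFun a := Localization.mk a 1
  map_zero' := Localization.mk_zero 1
  map_one' := Localization.mk_one
  map_mul' a b := by rw [Localization.mk_mul, one_mul]

/-- The pre-addition on `S⁻¹A` generated by all relations `∑ aᵢ/1 ≡ ∑ bⱼ/1` with `∑ aᵢ ≡ ∑ bⱼ`
in `B`. -/
def localizationRel : RingCon (FormalSum (Localization S)) :=
  ringConGen fun X Y => ∃ x y : FormalSum B, B.rel x y ∧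
    X = FormalSum.map (B.localizationMap S) x ∧ Y = FormalSum.map (B.localizationMap S) y

/-- Comparison of `S⁻¹A` with the localization of the semiring `ℕ[A]/R`. -/
def localizationCompare :
    Localization S →* Localization (S.map B.toSemiring) :=
  (Localization.monoidOf S).lift
    (g := (Localization.monoidOf (S.map B.toSemiring)).toMonoidHom.comp B.toSemiring)
    (fun s => (Localization.monoidOf (S.map B.toSemiring)).map_units
      ⟨B.toSemiring s, Submonoid.mem_map_of_mem _ s.2⟩)

lemma localizationCompare_mk_one (a : B) :
    B.localizationCompare S (Localization.mk a 1) = Localization.mk (B.toSemiring a) 1 := by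
  rw [Localization.mk_one_eq_monoidOf_mk]
  exact Submonoid.LocalizationMap.lift_eq _ _ _

lemma localizationRel_compare {X Y : FormalSum (Localization S)} (h : B.localizationRel S X Y) :
    FormalSum.eval (B.localizationCompare S) X = FormalSum.eval (B.localizationCompare S) Y := by
  have hle : B.localizationRel S ≤ RingCon.ker (FormalSum.eval (B.localizationCompare S)) := by
    refine RingCon.ringConGen_le.mpr ?_
    rintro X Y ⟨x, y, hxy, rfl, rfl⟩
    change FormalSum.eval _ _ = FormalSum.eval _ _
    have key : (B.localizationCompare S).comp (B.localizationMap S : B →* Localization S) =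
        ((algebraMap (ConQuotient B.rel) (Localization (S.map B.toSemiring)) :
          ConQuotient B.rel →+* _) : ConQuotient B.rel →* _).comp B.toSemiring := by
      ext a
      exact B.localizationCompare_mk_one S a
    rw [FormalSum.eval_map, FormalSum.eval_map, key, ← FormalSum.comp_eval, ← FormalSum.comp_eval,
      B.eval_toSemiring_eq hxy]
  exact hle h

lemma localizationCompare_injective : Function.Injective (B.localizationCompare S) := by
  intro z w h
  induction z using Localization.ind with | _ p =>
  induction w using Localization.ind with | _ q =>
  obtain ⟨a, s⟩ := p
  obtain ⟨b, t⟩ := q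
  have hm : ∀ (c : B) (r : S), Localization.mk c r * Localization.mk (r : B) 1 =
      Localization.mk c (1 : S) := by
    intro c r
    rw [Localization.mk_mul, Localization.mk_eq_mk_iff, Localization.r_iff_exists]
    exact ⟨1, by simp [mul_comm]⟩
  have h1 : B.localizationCompare S (Localization.mk (a * t) 1) =
      B.localizationCompare S (Localization.mk (b * s) 1) := by
    have e1 : (Localization.mk (a * t) 1 : Localization S) =
        Localization.mk a s * (Localization.mk (s : B) 1 * Localization.mk (t : B) 1) := by
      rw [← mul_assoc, hm, Localization.mk_mul, one_mul]
    have e2 : (Localization.mk (b * s) 1 : Localization S) =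
        Localization.mk b t * (Localization.mk (s : B) 1 * Localization.mk (t : B) 1) := by
      rw [mul_comm (Localization.mk (s : B) 1), ← mul_assoc, hm, Localization.mk_mul, one_mul]
    rw [e1, e2, map_mul, h, ← map_mul]
  rw [localizationCompare_mk_one, localizationCompare_mk_one, Localization.mk_eq_mk_iff,
    Localization.r_iff_exists] at h1
  obtain ⟨⟨_, c, hc, rfl⟩, h1⟩ := h1
  simp only [OneMemClass.coe_one, one_mul, ← map_mul] at h1
  have h2 := B.toSemiring_injective h1
  rw [Localization.mk_eq_mk_iff, Localization.r_iff_exists]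
  refine ⟨⟨c, hc⟩, ?_⟩
  simpa [mul_comm] using h2

/-- The localization `S⁻¹B`. -/
def localization : Blueprint.{u} where
  carrier := Localization S
  rel := B.localizationRel S
  rel_zero := by
    refine RingCon.le_ringConGen _ _ ⟨FormalSum.of 0, 0, B.rel_zero, ?_, ?_⟩
    · simp only [FormalSum.map_of, map_zero (B.localizationMap S)]
    · rw [map_zero]
  eq_of_rel a b h := by
    apply B.localizationCompare_injective S
    simpa using B.localizationRel_compare S h

end Localization

/-! ### The monoid blueprint `B[M]` -/

section Smash

/-- The congruence on `A × M` generated by `(a, 0) ~ (b, 0)` and `(0, m) ~ (0, n)`: all pairs with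
a vanishing coordinate are identified with each other. -/
def smashCon (A M : Type u) [CommMonoidWithZero A] [CommMonoidWithZero M] : Con (A × M) where
  r p q := p = q ∨ ((p.1 = 0 ∨ p.2 = 0) ∧ (q.1 = 0 ∨ q.2 = 0))
  iseqv := ⟨fun _ => Or.inl rfl, by
    rintro p q (h | h)
    · exact Or.inl h.symm
    · exact Or.inr h.symm, by
    rintro p q r (rfl | h) (rfl | h')
    · exact Or.inl rfl
    · exact Or.inr h'
    · exact Or.inr h
    · exact Or.inr ⟨h.1, h'.2⟩⟩
  mul' := by
    rintro p q r s (rfl | ⟨h1, h2⟩) (rfl | ⟨h3, h4⟩)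
    · exact Or.inl rfl
    · right
      constructor
      · rcases h3 with h | h <;> simp [h]
      · rcases h4 with h | h <;> simp [h]
    · right
      constructor
      · rcases h1 with h | h <;> simp [h]
      · rcases h2 with h | h <;> simp [h]
    · right
      constructor
      · rcases h1 with h | h <;> simp [h]
      · rcases h2 with h | h <;> simp [h]

/-- `smashCon` is the equivalence relation generated by `(a, 0) ~ (b, 0)` and
`(0, m) ~ (0, n)`. -/
lemma smashCon_iff_eqvGen (A M : Type u) [CommMonoidWithZero A] [CommMonoidWithZero M]
    (p q : A × M) : smashCon A M p q ↔
      Relation.EqvGen (fun p q : A × M => (p.2 = 0 ∧ q.2 = 0) ∨ (p.1 = 0 ∧ q.1 = 0)) p q := by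
  constructor
  · rintro (rfl | ⟨h1, h2⟩)
    · exact Relation.EqvGen.refl _
    · have h : ∀ r : A × M, (r.1 = 0 ∨ r.2 = 0) →
          Relation.EqvGen (fun p q : A × M => (p.2 = 0 ∧ q.2 = 0) ∨ (p.1 = 0 ∧ q.1 = 0)) r 0 := by
        rintro r (h | h)
        · exact Relation.EqvGen.rel _ _ (Or.inr ⟨h, rfl⟩)
        · exact Relation.EqvGen.rel _ _ (Or.inl ⟨h, rfl⟩)
      exact (h p h1).trans _ _ _ ((h q h2).symm _ _)
  · intro h
    induction h with
    | rel p q h =>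
      rcases h with h | h
      · exact Or.inr ⟨Or.inr h.1, Or.inr h.2⟩
      · exact Or.inr ⟨Or.inl h.1, Or.inl h.2⟩
    | refl p => exact (smashCon A M).refl p
    | symm p q _ h => exact (smashCon A M).symm h
    | trans p q r _ _ h1 h2 => exact (smashCon A M).trans h1 h2

/-- The smash product `A ∧ M` of monoids with zero. -/
def Smash (A M : Type u) [CommMonoidWithZero A] [CommMonoidWithZero M] : Type u :=
  (smashCon A M).Quotient

variable {A M N : Type u} [CommMonoidWithZero A] [CommMonoidWithZero M] [CommMonoidWithZero N]

instance : CommMonoid (Smash A M) := inferInstanceAs (CommMonoid (smashCon A M).Quotient)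

/-- The class `a ∧ m` of a pair. -/
def Smash.mk (a : A) (m : M) : Smash A M := (smashCon A M).mk' (a, m)

lemma Smash.mk_mul (a b : A) (m n : M) :
    Smash.mk a m * Smash.mk b n = Smash.mk (a * b) (m * n) := rfl

lemma Smash.one_def : (1 : Smash A M) = Smash.mk 1 1 := rfl

lemma Smash.ind {p : Smash A M → Prop} (h : ∀ a m, p (Smash.mk a m)) (z : Smash A M) : p z := by
  induction z using Con.induction_on with
  | _ x => exact h x.1 x.2

lemma Smash.mk_eq_iff {a b : A} {m n : M} : Smash.mk a m = Smash.mk b n ↔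
    (a = b ∧ m = n) ∨ ((a = 0 ∨ m = 0) ∧ (b = 0 ∨ n = 0)) := by
  rw [← Prod.mk_inj]
  exact (smashCon A M).eq

instance : CommMonoidWithZero (Smash A M) where
  zero := Smash.mk 0 0
  zero_mul z := by
    induction z using Smash.ind with
    | _ a m => exact (Smash.mk_mul _ _ _ _).trans (by rw [zero_mul, zero_mul]; rfl)
  mul_zero z := by
    induction z using Smash.ind with
    | _ a m => exact (Smash.mk_mul _ _ _ _).trans (by rw [mul_zero, mul_zero]; rfl)

lemma Smash.zero_def : (0 : Smash A M) = Smash.mk 0 0 := rfl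

/-- The inclusion `A → A ∧ M`, `a ↦ a ∧ 1`. -/
def Smash.inl (A M : Type u) [CommMonoidWithZero A] [CommMonoidWithZero M] : A →*₀ Smash A M where
  toFun a := Smash.mk a 1
  map_zero' := Smash.mk_eq_iff.mpr (Or.inr ⟨Or.inl rfl, Or.inl rfl⟩)
  map_one' := rfl
  map_mul' a b := by rw [Smash.mk_mul, one_mul]

/-- The map `A ∧ M → A ∧ N`, `a ∧ m ↦ a ∧ f m`, induced by a morphism `f : M → N`. -/
def Smash.map (A : Type u) [CommMonoidWithZero A] (f : M →*₀ N) : Smash A M →*₀ Smash A N where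
  toFun := Quotient.lift (fun p : A × M => Smash.mk p.1 (f p.2)) (by
    rintro p q (rfl | ⟨h1, h2⟩)
    · rfl
    · refine Smash.mk_eq_iff.mpr (Or.inr ⟨h1.imp id ?_, h2.imp id ?_⟩) <;>
      · intro h
        rw [h, map_zero])
  map_zero' := by
    change Smash.mk 0 (f 0) = Smash.mk 0 0
    rw [map_zero]
  map_one' := by
    change Smash.mk 1 (f 1) = Smash.mk 1 1
    rw [map_one]
  map_mul' z w := by
    induction z using Smash.ind with
    | _ a m =>
      induction w using Smash.ind with
      | _ b n =>
        change Smash.mk (a * b) (f (m * n)) = Smash.mk (a * b) (f m * f n)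
        rw [map_mul]

lemma Smash.map_mk (f : M →*₀ N) (a : A) (m : M) :
    Smash.map A f (Smash.mk a m) = Smash.mk a (f m) := rfl

end Smash

section MonoidBlueprint

variable (B : Blueprint.{u}) (M N : Type u) [CommMonoidWithZero M] [CommMonoidWithZero N]

/-- The pre-addition on `A ∧ M` generated by the relations `∑ aᵢ ∧ 1 ≡ ∑ bⱼ ∧ 1` with
`∑ aᵢ ≡ ∑ bⱼ` in `B`. -/
def monoidBlueprintRel : RingCon (FormalSum (Smash B M)) :=
  ringConGen fun X Y => ∃ x y : FormalSum B, B.rel x y ∧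
    X = FormalSum.map (Smash.inl B M) x ∧ Y = FormalSum.map (Smash.inl B M) y

/-- Equality of all coefficients at non-zero elements of `M`. -/
def coeffCon (R : Type u) [CommSemiring R] : RingCon (MonoidAlgebra R M) :=
  have key : ∀ f f' g : MonoidAlgebra R M, (∀ m, m ≠ 0 → f.coeff m = f'.coeff m) →
      ∀ m, m ≠ 0 → (f * g).coeff m = (f' * g).coeff m := by
    classical
    intro f f' g h m hm
    have hk : ∀ k : MonoidAlgebra R M, (k * g).coeff m =
        (MonoidAlgebra.ofCoeff (k.coeff.erase 0) * g).coeff m := by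
      intro k
      have hs : k = MonoidAlgebra.ofCoeff (k.coeff.erase 0) +
          MonoidAlgebra.single 0 (k.coeff 0) := by
        ext n
        by_cases hn : n = 0
        · simp [hn]
        · simp
      conv_lhs => rw [hs, add_mul]
      have hz : (MonoidAlgebra.single (0 : M) (k.coeff 0) * g).coeff m = 0 := by
        rw [MonoidAlgebra.coeff_mul]
        simp [Ne.symm hm]
      simp [hz]
    have he : f.coeff.erase 0 = f'.coeff.erase 0 := by
      ext n
      by_cases hn : n = 0
      · simp [hn]
      · simp [hn, h n hn]
    rw [hk f, hk f', he]
  { r := fun f g => ∀ m, m ≠ 0 → f.coeff m = g.coeff m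
    iseqv := ⟨fun _ _ _ => rfl, fun h m hm => (h m hm).symm,
      fun h h' m hm => (h m hm).trans (h' m hm)⟩
    add' := fun h h' m hm => by simp [h m hm, h' m hm]
    mul' := fun {f f' g g'} h h' m hm => by
      rw [key f f' g h m hm, mul_comm f', key g g' f' h' m hm, mul_comm f'] }

/-- Comparison of `A ∧ M` with a monoid algebra modulo its coefficients at `0 ∈ M`. -/
def smashCompare : Smash B M →* ConQuotient (coeffCon M (ConQuotient B.rel)) where
  toFun := Quotient.lift
    (fun p : B × M => (ConQuotient.mk (coeffCon M (ConQuotient B.rel)))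
      (MonoidAlgebra.single p.2 (B.toSemiring p.1))) (by
    have h0 : B.toSemiring 0 = 0 := B.toSemiring_zero
    have hz : ∀ p : B × M, (p.1 = 0 ∨ p.2 = 0) → (ConQuotient.mk (coeffCon M (ConQuotient B.rel)))
        (MonoidAlgebra.single p.2 (B.toSemiring p.1)) = 0 := by
      rintro ⟨a, m⟩ (h | h)
      · simp only at h
        simp [h, h0]
      · simp only at h
        refine (ConQuotient.mk_eq_iff _).mpr ?_
        intro n hn
        simp [h, Ne.symm hn]
    rintro p q (rfl | ⟨h1, h2⟩)
    · rfl
    · exact (hz p h1).trans (hz q h2).symm)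
  map_one' := by
    change (ConQuotient.mk (coeffCon M (ConQuotient B.rel))) (MonoidAlgebra.single 1 (B.toSemiring 1)) = 1
    rw [map_one, ← MonoidAlgebra.one_def, map_one]
  map_mul' z w := by
    induction z using Smash.ind with
    | _ a m =>
      induction w using Smash.ind with
      | _ b n =>
        change (ConQuotient.mk (coeffCon M (ConQuotient B.rel))) (MonoidAlgebra.single (m * n) (B.toSemiring (a * b)))
          = (ConQuotient.mk (coeffCon M (ConQuotient B.rel))) (MonoidAlgebra.single m (B.toSemiring a)) *
            (ConQuotient.mk (coeffCon M (ConQuotient B.rel))) (MonoidAlgebra.single n (B.toSemiring b))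
        rw [← map_mul, MonoidAlgebra.single_mul_single, map_mul B.toSemiring]

lemma smashCompare_injective : Function.Injective (B.smashCompare M) := by
  classical
  have h0 : B.toSemiring 0 = 0 := B.toSemiring_zero
  intro z w h
  induction z using Smash.ind with
  | _ a m =>
    induction w using Smash.ind with
    | _ b n =>
      have h' : ∀ k : M, k ≠ 0 → (MonoidAlgebra.single m (B.toSemiring a)).coeff k =
          (MonoidAlgebra.single n (B.toSemiring b)).coeff k :=
        (ConQuotient.mk_eq_iff _).mp h
      simp only [MonoidAlgebra.coeff_single, Finsupp.single_apply] at h'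
      rw [Smash.mk_eq_iff]
      have hz : ∀ c : B, B.toSemiring c = 0 → c = 0 := fun c hc =>
        B.toSemiring_injective (hc.trans h0.symm)
      by_cases hm : m = 0
      · by_cases hn : n = 0
        · exact Or.inr ⟨Or.inr hm, Or.inr hn⟩
        · have := h' n hn
          rw [if_neg (by rintro rfl; exact hn hm), if_pos rfl] at this
          exact Or.inr ⟨Or.inr hm, Or.inl (hz _ this.symm)⟩
      · by_cases hmn : n = m
        · subst hmn
          have := h' n hm
          rw [if_pos rfl, if_pos rfl] at this
          exact Or.inl ⟨B.toSemiring_injective this, rfl⟩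
        · have h1 := h' m hm
          rw [if_pos rfl, if_neg hmn] at h1
          refine Or.inr ⟨Or.inl (hz _ h1), ?_⟩
          by_cases hn : n = 0
          · exact Or.inr hn
          · have h2 := h' n hn
            rw [if_pos rfl, if_neg (Ne.symm hmn)] at h2
            exact Or.inl (hz _ h2.symm)

lemma monoidBlueprintRel_compare {X Y : FormalSum (Smash B M)} (h : B.monoidBlueprintRel M X Y) :
    FormalSum.eval (B.smashCompare M) X = FormalSum.eval (B.smashCompare M) Y := by
  have hle : B.monoidBlueprintRel M ≤ RingCon.ker (FormalSum.eval (B.smashCompare M)) := by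
    refine RingCon.ringConGen_le.mpr ?_
    rintro X Y ⟨x, y, hxy, rfl, rfl⟩
    change FormalSum.eval _ _ = FormalSum.eval _ _
    have key : (B.smashCompare M).comp (Smash.inl B M : B →* Smash B M) =
        ((((ConQuotient.mk (coeffCon M (ConQuotient B.rel)))).comp MonoidAlgebra.singleOneRingHom :
          ConQuotient B.rel →+* ConQuotient (coeffCon M (ConQuotient B.rel))) :
          ConQuotient B.rel →* ConQuotient (coeffCon M (ConQuotient B.rel))).comp B.toSemiring := rfl
    rw [FormalSum.eval_map, FormalSum.eval_map, key, ← FormalSum.comp_eval, ← FormalSum.comp_eval,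
      B.eval_toSemiring_eq hxy]
  exact hle h

/-- The monoid blueprint `B[M]` of `M` over `B`. -/
def monoidBlueprint : Blueprint.{u} where
  carrier := Smash B M
  rel := B.monoidBlueprintRel M
  rel_zero := by
    refine RingCon.le_ringConGen _ _ ⟨FormalSum.of 0, 0, B.rel_zero, ?_, ?_⟩
    · simp only [FormalSum.map_of, map_zero (Smash.inl B M)]
    · rw [map_zero]
  eq_of_rel a b h := by
    apply B.smashCompare_injective M
    simpa using B.monoidBlueprintRel_compare M h

/-- The canonical morphism `B → B[M]`, `a ↦ a ∧ 1`. -/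
def toMonoidBlueprint : B ⟶ B.monoidBlueprint M where
  toMonoidHom := Smash.inl B M
  map_rel x y h := RingCon.le_ringConGen _ _ ⟨x, y, h, rfl, rfl⟩

variable {M N} in
/-- The morphism `B[M] → B[N]` induced by a morphism of monoids `M → N`. -/
def monoidBlueprintMap (f : M →*₀ N) : B.monoidBlueprint M ⟶ B.monoidBlueprint N where
  toMonoidHom := Smash.map B f
  map_rel x y h := by
    have hle : B.monoidBlueprintRel M ≤
        (B.monoidBlueprintRel N).comap (FormalSum.map (Smash.map B f)) := by
      refine RingCon.ringConGen_le.mpr ?_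
      rintro X Y ⟨x, y, hxy, rfl, rfl⟩
      have hc : (Smash.map B f).comp (Smash.inl B M) = Smash.inl B N := by
        ext a
        exact congrArg (Smash.mk a) (map_one f)
      refine RingCon.le_ringConGen _ _ ⟨x, y, hxy, ?_, ?_⟩ <;>
        rw [← FormalSum.map_comp, hc]
    exact hle h

end MonoidBlueprint

/-! ### The spectrum of a blueprint -/

/-- A prime ideal of a blueprint. An ideal is a subset `I` with `0 ∈ I` and `I·B ⊆ I` such that
`c ∈ I` whenever there is an additive relation `∑ aᵢ + c ≡ ∑ bⱼ` with all `aᵢ, bⱼ ∈ I`; it is prime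
if its complement is a multiplicative set. -/
@[ext]
structure PrimeIdeal (B : Blueprint.{u}) : Type u where
  /-- the underlying set -/
  carrier : Set B
  zero_mem : 0 ∈ carrier
  mul_mem : ∀ a b : B, a ∈ carrier → a * b ∈ carrier
  mem_of_rel : ∀ (x y : FormalSum B) (c : B), (∀ a ∈ x.coeff.support, a ∈ carrier) →
    (∀ b ∈ y.coeff.support, b ∈ carrier) → B.rel (x + FormalSum.of c) y → c ∈ carrier
  one_notMem : 1 ∉ carrier
  mem_or_mem : ∀ a b : B, a * b ∈ carrier → a ∈ carrier ∨ b ∈ carrier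

namespace PrimeIdeal

variable {B : Blueprint.{u}}

/-- The basic open set `D(h)` of all prime ideals not containing `h`. -/
def basicOpen (h : B) : Set (PrimeIdeal B) := {p | h ∉ p.carrier}

/-- The topology on the prime ideals generated by the basic open sets. -/
instance : TopologicalSpace (PrimeIdeal B) :=
  TopologicalSpace.generateFrom (Set.range basicOpen)

/-- The complement of a prime ideal. -/
def compl (p : PrimeIdeal B) : Submonoid B where
  carrier := {b | b ∉ p.carrier}
  one_mem' := p.one_notMem
  mul_mem' {a b} ha hb hab := (p.mem_or_mem a b hab).elim ha hb

/-- The localization `B_p` of a blueprint at a prime ideal. -/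
def localizationAt (p : PrimeIdeal B) : Blueprint.{u} := B.localization p.compl

/-- The fraction `a / f` in `B_p`, for `f ∉ p`. -/
def frac (p : PrimeIdeal B) (a f : B) (hf : f ∉ p.carrier) : p.localizationAt :=
  Localization.mk a ⟨f, hf⟩

lemma frac_mul (p : PrimeIdeal B) (a b f g : B) (hf : f ∉ p.carrier) (hg : g ∉ p.carrier) :
    p.frac a f hf * p.frac b g hg =
      p.frac (a * b) (f * g) (fun h => (p.mem_or_mem f g h).elim hf hg) :=
  Localization.mk_mul _ _ _ _

lemma frac_one (p : PrimeIdeal B) : p.frac 1 1 p.one_notMem = 1 := Localization.mk_one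

lemma frac_zero (p : PrimeIdeal B) : p.frac 0 1 p.one_notMem = 0 := Localization.mk_zero 1

end PrimeIdeal

section Spec

variable (B : Blueprint.{u})

/-- The prime spectrum as an object of `TopCat`. -/
def specTop : TopCat.{u} := TopCat.of (PrimeIdeal B)

variable {B}

/-- A family of elements of the localizations `B_p` for `p ∈ U` is locally a fraction. -/
def IsLocallyFraction {U : Opens B.specTop}
    (s : ∀ p : U, PrimeIdeal.localizationAt (B := B) p.1) : Prop :=
  ∀ p : U, ∃ V : Opens B.specTop, p.1 ∈ V ∧ ∃ hVU : V ≤ U, ∃ a f : B,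
    ∀ q : V, ∃ hf : f ∉ PrimeIdeal.carrier (B := B) q.1,
      s ⟨q.1, hVU q.2⟩ = PrimeIdeal.frac q.1 a f hf

/-- The sections of the structure sheaf of `Spec B` over `U`. -/
def Section (U : Opens B.specTop) : Type u :=
  {s : ∀ p : U, PrimeIdeal.localizationAt (B := B) p.1 // IsLocallyFraction s}

namespace Section

variable {U V W : Opens B.specTop}

@[ext] lemma ext {s t : Section U} (h : ∀ p, s.1 p = t.1 p) : s = t := Subtype.ext (funext h)

instance : One (Section U) :=
  ⟨1, fun p => ⟨U, p.2, le_rfl, 1, 1, fun q => ⟨PrimeIdeal.one_notMem q.1,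
    (PrimeIdeal.frac_one (B := B) q.1).symm⟩⟩⟩

instance : Zero (Section U) :=
  ⟨0, fun p => ⟨U, p.2, le_rfl, 0, 1, fun q => ⟨PrimeIdeal.one_notMem q.1,
    (PrimeIdeal.frac_zero (B := B) q.1).symm⟩⟩⟩

instance : Mul (Section U) :=
  ⟨fun s t => ⟨s.1 * t.1, fun p => by
    obtain ⟨V, hpV, hV, a, f, h⟩ := s.2 p
    obtain ⟨W, hpW, hW, b, g, k⟩ := t.2 p
    refine ⟨V ⊓ W, ⟨hpV, hpW⟩, inf_le_left.trans hV, a * b, f * g, fun q => ?_⟩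
    obtain ⟨hf, h1⟩ := h ⟨q.1, q.2.1⟩
    obtain ⟨hg, h2⟩ := k ⟨q.1, q.2.2⟩
    refine ⟨fun hh => (PrimeIdeal.mem_or_mem q.1 f g hh).elim hf hg, ?_⟩
    rw [← PrimeIdeal.frac_mul (B := B) q.1 a b f g hf hg, ← h1, ← h2]
    rfl⟩⟩

instance : CommMonoidWithZero (Section U) where
  mul_assoc s t r := ext fun p => mul_assoc (s.1 p) (t.1 p) (r.1 p)
  one_mul s := ext fun p => one_mul (s.1 p)
  mul_one s := ext fun p => mul_one (s.1 p)
  mul_comm s t := ext fun p => mul_comm (s.1 p) (t.1 p)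
  zero_mul s := ext fun p => zero_mul (s.1 p)
  mul_zero s := ext fun p => mul_zero (s.1 p)

/-- The germ of a section at a point. -/
def germ (U : Opens B.specTop) (p : U) :
    Section U →*₀ PrimeIdeal.localizationAt (B := B) p.1 where
  toFun s := s.1 p
  map_zero' := rfl
  map_one' := rfl
  map_mul' _ _ := rfl

/-- The restriction of sections. -/
def res (h : V ≤ U) : Section U →*₀ Section V where
  toFun s := ⟨fun p => s.1 ⟨p.1, h p.2⟩, fun p => by
    obtain ⟨W, hpW, hW, a, f, k⟩ := s.2 ⟨p.1, h p.2⟩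
    exact ⟨W ⊓ V, ⟨hpW, p.2⟩, inf_le_right, a, f, fun q => k ⟨q.1, q.2.1⟩⟩⟩
  map_zero' := rfl
  map_one' := rfl
  map_mul' _ _ := rfl

end Section

/-- The blueprint of sections over `U`: an additive relation between sections holds if and only if
it holds in all localizations `B_p` with `p ∈ U`. -/
def sectionBlueprint (U : Opens B.specTop) : Blueprint.{u} where
  carrier := Section U
  rel :=
    { r := fun x y => ∀ p : U, (PrimeIdeal.localizationAt (B := B) p.1).rel
        (FormalSum.map (Section.germ U p) x) (FormalSum.map (Section.germ U p) y)
      iseqv := ⟨fun _ _ => RingCon.refl _ _, fun h p => RingCon.symm _ (h p),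
        fun h h' p => RingCon.trans _ (h p) (h' p)⟩
      add' := fun h h' p => by
        rw [map_add (FormalSum.map _), map_add (FormalSum.map _)]
        exact RingCon.add _ (h p) (h' p)
      mul' := fun h h' p => by
        rw [map_mul (FormalSum.map _), map_mul (FormalSum.map _)]
        exact RingCon.mul _ (h p) (h' p) }
  rel_zero := by
    intro p
    rw [FormalSum.map_of, map_zero (Section.germ U p), map_zero (FormalSum.map _)]
    exact (PrimeIdeal.localizationAt (B := B) p.1).rel_zero
  eq_of_rel s t h := by
    refine Section.ext fun p => ?_
    have hp := h p
    rw [FormalSum.map_of, FormalSum.map_of] at hp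
    exact (PrimeIdeal.localizationAt (B := B) p.1).eq_of_rel _ _ hp

lemma sectionBlueprint_rel_iff {U : Opens B.specTop} (x y : FormalSum (Section U)) :
    (sectionBlueprint U).rel x y ↔ ∀ p : U, (PrimeIdeal.localizationAt (B := B) p.1).rel
      (FormalSum.map (Section.germ U p) x) (FormalSum.map (Section.germ U p) y) := Iff.rfl

variable (B)

/-- The structure presheaf of `Spec B`. -/
def specPresheaf : TopCat.Presheaf Blueprint.{u} B.specTop where
  obj U := sectionBlueprint U.unop
  map {U V} i :=
    { toMonoidHom := Section.res i.unop.le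
      map_rel := fun x y h => by
        refine (sectionBlueprint_rel_iff _ _).mpr fun p => ?_
        have hp := (sectionBlueprint_rel_iff _ _).mp h ⟨p.1, i.unop.le p.2⟩
        erw [← FormalSum.map_comp, ← FormalSum.map_comp]
        exact hp }

/-- The structure presheaf of `Spec B` is a sheaf. -/
lemma specPresheaf_isSheaf : B.specPresheaf.IsSheaf := by
  intro E U S hS x hx
  have hcov : ∀ p : U, ∃ (V : Opens B.specTop) (f : V ⟶ U), S f ∧ p.1 ∈ V :=
    fun p => hS p.1 p.2
  -- the value of a glued section, computed on any member of the covering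
  let val : ∀ {V : Opens B.specTop} (f : V ⟶ U), S f → E → ∀ q : V,
      PrimeIdeal.localizationAt (B := B) q.1 := fun {V} f hf e q =>
    Section.germ V q ((x f hf : E ⟶ sectionBlueprint V).toMonoidHom e)
  have hind : ∀ {V W : Opens B.specTop} (f : V ⟶ U) (hf : S f) (g : W ⟶ U) (hg : S g)
      (e : E) (q : B.specTop) (hqV : q ∈ V) (hqW : q ∈ W),
      val f hf e ⟨q, hqV⟩ = val g hg e ⟨q, hqW⟩ := by
    intro V W f hf g hg e q hqV hqW
    have h := hx (Y₁ := V) (Y₂ := W) (Z := V ⊓ W) (homOfLE inf_le_left) (homOfLE inf_le_right)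
      hf hg (Subsingleton.elim _ _)
    have h' := congrArg (fun k : E ⟶ sectionBlueprint (V ⊓ W) =>
      Section.germ (V ⊓ W) ⟨q, hqV, hqW⟩ (k.toMonoidHom e)) h
    exact h'
  choose V f hf hpV using hcov
  let t : E ⟶ sectionBlueprint U :=
    { toMonoidHom :=
        { toFun := fun e => (⟨fun p => val (f p) (hf p) e ⟨p.1, hpV p⟩, fun p => by
            obtain ⟨W, hpW, hW, a, g, k⟩ :=
              ((x (f p) (hf p) : E ⟶ sectionBlueprint (V p)).toMonoidHom e).2 ⟨p.1, hpV p⟩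
            refine ⟨W, hpW, hW.trans (f p).le, a, g, fun q => ?_⟩
            obtain ⟨hg, hq⟩ := k q
            refine ⟨hg, Eq.trans ?_ hq⟩
            exact hind _ _ (f p) (hf p) e q.1 _ (hW q.2)⟩ : Section U)
          map_zero' := Section.ext fun p => congrArg (Section.germ (V p) ⟨p.1, hpV p⟩)
            (x (f p) (hf p) : E ⟶ sectionBlueprint (V p)).toMonoidHom.map_zero
          map_one' := Section.ext fun p => congrArg (Section.germ (V p) ⟨p.1, hpV p⟩)
            (x (f p) (hf p) : E ⟶ sectionBlueprint (V p)).toMonoidHom.map_one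
          map_mul' := fun a b => Section.ext fun p =>
            congrArg (Section.germ (V p) ⟨p.1, hpV p⟩)
              ((x (f p) (hf p) : E ⟶ sectionBlueprint (V p)).toMonoidHom.map_mul a b) }
      map_rel := fun y z h => by
        refine (sectionBlueprint_rel_iff _ _).mpr fun p => ?_
        have h1 := (sectionBlueprint_rel_iff _ _).mp
          ((x (f p) (hf p) : E ⟶ sectionBlueprint (V p)).map_rel y z h) ⟨p.1, hpV p⟩
        erw [← FormalSum.map_comp, ← FormalSum.map_comp] at h1 ⊢
        exact h1 }
  refine ⟨t, fun W g hg => ?_, fun t' ht' => ?_⟩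
  · refine hom_ext fun e => Section.ext fun q => ?_
    exact hind _ _ g hg e q.1 _ q.2
  · refine hom_ext fun e => Section.ext fun p => ?_
    have h := congrArg (fun k : E ⟶ sectionBlueprint (V p) =>
      Section.germ (V p) ⟨p.1, hpV p⟩ (k.toMonoidHom e)) (ht' (f p) (hf p))
    exact h

/-- The spectrum of a blueprint: the space of prime ideals with its structure sheaf. -/
def spec : SheafedSpace Blueprint.{u} where
  carrier := B.specTop
  presheaf := B.specPresheaf
  IsSheaf := B.specPresheaf_isSheaf

/-- The canonical morphism `B → Γ(Spec B, 𝒪)`, `a ↦ a / 1`. -/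
def toGlobalSections : B ⟶ B.spec.presheaf.obj (op ⊤) where
  toMonoidHom :=
    { toFun := fun a => (⟨fun p => PrimeIdeal.frac p.1 a 1 (PrimeIdeal.one_notMem p.1),
        fun p => ⟨⊤, trivial, le_rfl, a, 1, fun q => ⟨PrimeIdeal.one_notMem q.1, rfl⟩⟩⟩ :
          Section (B := B) ⊤)
      map_zero' := Section.ext fun p => PrimeIdeal.frac_zero (B := B) p.1
      map_one' := Section.ext fun p => PrimeIdeal.frac_one (B := B) p.1
      map_mul' := fun a b => Section.ext fun p =>
        (B.localizationMap (PrimeIdeal.compl p.1)).map_mul a b }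
  map_rel x y h := by
    refine (sectionBlueprint_rel_iff _ _).mpr fun p => ?_
    erw [← FormalSum.map_comp, ← FormalSum.map_comp]
    exact RingCon.le_ringConGen _ _ ⟨x, y, h, rfl, rfl⟩

end Spec

end Blueprint

/-! ### Blue schemes -/

/-- The open subspace `U` of a space with a sheaf of blueprints. -/
def openSubspace (X : SheafedSpace Blueprint.{u}) (U : Opens X) : SheafedSpace Blueprint.{u} :=
  X.restrict U.isOpenEmbedding

/-- A blue scheme: a topological space with a sheaf of blueprints that is covered by open subspaces
isomorphic to spectra of blueprints. -/
structure BlueScheme extends SheafedSpace Blueprint.{u} where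
  local_affine : ∀ x : toSheafedSpace, ∃ U : Opens toSheafedSpace, x ∈ U ∧
    ∃ C : Blueprint.{u}, Nonempty (openSubspace toSheafedSpace U ≅ C.spec)

/-- A blue scheme `X` over a blueprint `B`. The structure morphism `X → Spec B` is given by the
corresponding morphism `B → Γ(X, 𝒪_X)`. -/
structure BlueSchemeOver (B : Blueprint.{u}) extends BlueScheme.{u} where
  /-- the structure morphism -/
  structureMap : B ⟶ presheaf.obj (op ⊤)

/-- The coordinate map `C → 𝒪_X(U)` of an open `U` with an isomorphism `U ≅ Spec C`. -/
def coordinateMap {X : SheafedSpace Blueprint.{u}} {U : Opens X} {C : Blueprint.{u}}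
    (e : openSubspace X U ≅ C.spec) : C ⟶ X.presheaf.obj (op U) :=
  C.toGlobalSections ≫ e.hom.hom.c.app (op ⊤) ≫
    X.presheaf.map (homOfLE (show U ≤ U.isOpenEmbedding.functor.obj ⊤ from
      fun x hx => ⟨⟨x, hx⟩, trivial, rfl⟩)).op

namespace BlueSchemeOver

variable {B : Blueprint.{u}} (X : BlueSchemeOver B)

/-- An identification, over `B`, of the open `U ⊆ X` with `Spec B[M]` for a monoid `M`. -/
structure MonoidChart (U : Opens X.toSheafedSpace) : Type (u + 1) where
  /-- the monoid -/
  M : Type u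
  [monoid : CommMonoidWithZero M]
  /-- the isomorphism -/
  iso : openSubspace X.toSheafedSpace U ≅ (B.monoidBlueprint M).spec
  compatible : B.toMonoidBlueprint M ≫ coordinateMap iso =
    X.structureMap ≫ X.presheaf.map (homOfLE (le_top : U ≤ ⊤)).op

instance {U : Opens X.toSheafedSpace} (c : X.MonoidChart U) : CommMonoidWithZero c.M := c.monoid

variable {X}

/-- For `V ⊆ U` with `U = Spec B[M]` and `V = Spec B[N]`: the restriction map `B[M] → B[N]` is
induced by a morphism `M → N` that is the localization at a multiplicative subset of `M`. -/
def MonoidChart.IsLocalization {U V : Opens X.toSheafedSpace} (c : X.MonoidChart U)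
    (d : X.MonoidChart V) : Prop :=
  ∃ (hVU : V ≤ U) (S : Submonoid c.M) (l : c.M →*₀ d.M), S.IsLocalizationMap l ∧
    coordinateMap c.iso ≫ X.presheaf.map (homOfLE hVU).op =
      B.monoidBlueprintMap l ≫ coordinateMap d.iso

variable (X)

/-- A monoidal scheme over `B`. -/
def IsMonoidal : Prop :=
  ∃ (ι : Type u) (U : ι → Opens X.toSheafedSpace) (c : ∀ i, X.MonoidChart (U i)),
    (⨆ i, U i = ⊤) ∧
    ∀ i j, ∃ (κ : Type u) (V : κ → Opens X.toSheafedSpace) (d : ∀ k, X.MonoidChart (V k)),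
      (⨆ k, V k = U i ⊓ U j) ∧ ∀ k, (c i).IsLocalization (d k) ∧ (c j).IsLocalization (d k)

end BlueSchemeOver

end

/-! The question is local: each point `x` of `U` lies in some chart `Spec B[M]`, and the basic open
sets `D(h)` form a basis there. Every element of `B[M]` is a single term `h = b ∧ m`, not a sum. If
`D(h)` contains a point then `b ≠ 0`, so `b` is a unit because `B` is a blue field, and multiplying
by a unit does not change a basic open set. Hence `D(h) = D(1 ∧ m)`, which is `Spec B[M[m⁻¹]]`: the
small neighbourhoods of `x` are again spectra of monoid blueprints.

The last identification carries the work. A blueprint is a monoid with a pre-addition, so a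
localization must be controlled on both levels. `IsLocalizationHom` asks that denominators become
units, that every element is a fraction, and that every additive relation in the target between
images holds in the source after multiplication by a denominator.
`isLocalizationHom_monoidBlueprintMap` shows that `B[M] → B[S⁻¹M]` has these properties.

For a localization at the powers of `h`, `comap` is an open embedding onto `D(h)`, and `localMap` is
injective and reflects relations. Sections and their relations are defined pointwise in the
localizations `B_p`, so pullback of sections is an isomorphism over opens contained in `D(h)`. This
makes `specMap` an open immersion (`isOpenImmersion_specMap`). Finally `comp_coordinateMap` shows
that the new chart is an isomorphism over `B`. -/

noncomputable section

/-! ### Universal property of localizations of monoids with zero -/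

namespace Submonoid.IsLocalizationMap

variable {M N P : Type*} [CommMonoidWithZero M] [CommMonoidWithZero N] [CommMonoidWithZero P]
  {S : Submonoid M} {l : M →*₀ N}

/-- The morphism of monoids with zero `S⁻¹M → P` induced by a morphism `M → P` that maps `S` to
units. -/
def liftWithZero (hl : S.IsLocalizationMap l) (g : M →*₀ P) (hg : ∀ s ∈ S, IsUnit (g s)) :
    N →*₀ P :=
  let L : S.LocalizationMap N := ⟨(l : M →ₙ* N), hl⟩
  { toFun := L.lift (g := (g : M →* P)) fun s => hg s s.2
    map_zero' := by
      have h := L.lift_eq (g := (g : M →* P)) (fun s => hg s s.2) 0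
      have h0 : L 0 = 0 := map_zero l
      rw [h0] at h
      exact h.trans (map_zero g)
    map_one' := map_one _
    map_mul' := map_mul _ }

lemma liftWithZero_apply (hl : S.IsLocalizationMap l) (g : M →*₀ P)
    (hg : ∀ s ∈ S, IsUnit (g s)) (m : M) : hl.liftWithZero g hg (l m) = g m :=
  Submonoid.LocalizationMap.lift_eq (⟨(l : M →ₙ* N), hl⟩ : S.LocalizationMap N)
    (g := (g : M →* P)) (fun s => hg s s.2) m

end Submonoid.IsLocalizationMap

/-! ### Formal sums with summands in a given subset -/

namespace FormalSum

variable {A C : Type u} [CommMonoidWithZero A] [CommMonoidWithZero C]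

/-- Ideals are defined by conditions on supports. Additive submonoids allow induction over sums
instead, and are easily transported along products and induced maps. -/
lemma mem_closure_of_iff (I : Set A) (x : FormalSum A) :
    x ∈ AddSubmonoid.closure (of '' I : Set (FormalSum A)) ↔ ∀ a ∈ x.coeff.support, a ∈ I := by
  classical
  constructor
  · intro hx
    induction hx using AddSubmonoid.closure_induction with
    | mem y hy =>
      obtain ⟨a, ha, rfl⟩ := hy
      intro b hb
      have : b = a := by
        simpa [of, MonoidAlgebra.of, Finsupp.single_apply] using hb
      exact this ▸ ha
    | zero => simp
    | add y z _ _ hy hz =>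
      intro a ha
      rw [MonoidAlgebra.coeff_add] at ha
      rcases Finset.mem_union.mp (Finsupp.support_add ha) with h | h
      · exact hy a h
      · exact hz a h
  · intro h
    have hx : x = ∑ a ∈ x.coeff.support, x.coeff a • (of a : FormalSum A) := by
      ext b
      simp [of, MonoidAlgebra.of, Finsupp.single_apply]
    rw [hx]
    exact AddSubmonoid.sum_mem _ fun a ha => AddSubmonoid.nsmul_mem _
      (AddSubmonoid.subset_closure (Set.mem_image_of_mem _ (h a ha))) _

lemma of_mul_mem_closure {I : Set A} {a : A} (ha : ∀ b ∈ I, a * b ∈ I) {x : FormalSum A}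
    (hx : x ∈ AddSubmonoid.closure (of '' I : Set (FormalSum A))) :
    of a * x ∈ AddSubmonoid.closure (of '' I : Set (FormalSum A)) := by
  induction hx using AddSubmonoid.closure_induction with
  | mem y hy =>
    obtain ⟨b, hb, rfl⟩ := hy
    rw [← map_mul of]
    exact AddSubmonoid.subset_closure (Set.mem_image_of_mem _ (ha b hb))
  | zero => rw [mul_zero]; exact zero_mem _
  | add y z _ _ hy hz => rw [mul_add]; exact add_mem hy hz

lemma map_mem_closure (f : A →*₀ C) {I : Set A} {J : Set C} (h : ∀ a ∈ I, f a ∈ J)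
    {x : FormalSum A} (hx : x ∈ AddSubmonoid.closure (of '' I : Set (FormalSum A))) :
    map f x ∈ AddSubmonoid.closure (of '' J : Set (FormalSum C)) := by
  induction hx using AddSubmonoid.closure_induction with
  | mem y hy =>
    obtain ⟨b, hb, rfl⟩ := hy
    rw [map_of]
    exact AddSubmonoid.subset_closure (Set.mem_image_of_mem _ (h b hb))
  | zero => rw [map_zero]; exact zero_mem _
  | add y z _ _ hy hz => rw [map_add]; exact add_mem hy hz

end FormalSum

/-! ### Localizations of blueprints -/

namespace Blueprint

variable {B C D E : Blueprint.{u}}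

lemma rel_of_mul (C : Blueprint.{u}) (c : C) {x y : FormalSum C} (h : C.rel x y) :
    C.rel (FormalSum.of c * x) (FormalSum.of c * y) :=
  RingCon.mul _ (RingCon.refl _ _) h

lemma rel_of_isUnit_mul (C : Blueprint.{u}) {c : C} (hc : IsUnit c) {x y : FormalSum C}
    (h : C.rel (FormalSum.of c * x) (FormalSum.of c * y)) : C.rel x y := by
  obtain ⟨d, hd⟩ := hc.exists_left_inv
  have := C.rel_of_mul d h
  rwa [← mul_assoc, ← mul_assoc, ← map_mul FormalSum.of, hd, map_one, one_mul, one_mul] at this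

/-- A bijective morphism of blueprints that reflects additive relations is an isomorphism. -/
lemma isIso_of_bijective (f : C ⟶ D) (hf : Function.Bijective f.toMonoidHom)
    (hrel : ∀ x y : FormalSum C, D.rel (FormalSum.map f.toMonoidHom x)
      (FormalSum.map f.toMonoidHom y) → C.rel x y) : IsIso f := by
  let e := Equiv.ofBijective _ hf
  let g : D →*₀ C :=
    { toFun := fun d => e.symm d
      map_zero' := e.injective (by simp [e])
      map_one' := e.injective (by simp [e])
      map_mul' := fun a b => hf.1 (by
        rw [map_mul f.toMonoidHom]
        exact (e.apply_symm_apply _).trans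
          (congrArg₂ (· * ·) (e.apply_symm_apply a) (e.apply_symm_apply b)).symm) }
  have hfg : f.toMonoidHom.comp g = MonoidWithZeroHom.id D :=
    MonoidWithZeroHom.ext fun d => e.apply_symm_apply d
  refine ⟨⟨⟨g, fun x y h => hrel _ _ ?_⟩, hom_ext fun c => e.symm_apply_apply c,
    hom_ext fun d => e.apply_symm_apply d⟩⟩
  rwa [← FormalSum.map_comp, ← FormalSum.map_comp, hfg, FormalSum.map_id, FormalSum.map_id]

lemma isLocalizationMap_localizationMap (C : Blueprint.{u}) (S : Submonoid C) :
    S.IsLocalizationMap (C.localizationMap S) :=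
  (Localization.monoidOf S).isLocalizationMap

/-- The morphism `C → S⁻¹C`, `a ↦ a / 1`. -/
def toLocalization (C : Blueprint.{u}) (S : Submonoid C) : C ⟶ C.localization S where
  toMonoidHom := C.localizationMap S
  map_rel x y h := RingCon.le_ringConGen _ _ ⟨x, y, h, rfl, rfl⟩

lemma isUnit_toLocalization {S : Submonoid C} {s : C} (hs : s ∈ S) :
    IsUnit ((C.toLocalization S).toMonoidHom s) :=
  (Localization.monoidOf S).map_units ⟨s, hs⟩

lemma mk_mul_toLocalization {S : Submonoid C} (c : C) (s : S) :
    C.localizationMap S s * Localization.mk c s = C.localizationMap S c := by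
  change Localization.mk (s : C) 1 * Localization.mk c s = Localization.mk c 1
  rw [Localization.mk_mul, Localization.mk_eq_mk_iff, Localization.r_iff_exists]
  exact ⟨1, by simp⟩

/-- The morphism `S⁻¹C → E` induced by a morphism `C → E` that maps `S` to units. -/
def localizationLift {S : Submonoid C} (f : C ⟶ E)
    (hf : ∀ s ∈ S, IsUnit (f.toMonoidHom s)) : C.localization S ⟶ E where
  toMonoidHom := (C.isLocalizationMap_localizationMap S).liftWithZero f.toMonoidHom hf
  map_rel := by
    let g : Localization S →*₀ E :=
      (C.isLocalizationMap_localizationMap S).liftWithZero f.toMonoidHom hf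
    have hle : C.localizationRel S ≤ E.rel.comap (FormalSum.map g) := by
      refine RingCon.ringConGen_le.mpr ?_
      rintro X Y ⟨x, y, hxy, rfl, rfl⟩
      change E.rel _ _
      have hc : g.comp (C.localizationMap S) = f.toMonoidHom :=
        MonoidWithZeroHom.ext fun c =>
          (C.isLocalizationMap_localizationMap S).liftWithZero_apply f.toMonoidHom hf c
      rw [← FormalSum.map_comp, ← FormalSum.map_comp, hc]
      exact f.map_rel _ _ hxy
    exact fun x y h => hle h

@[simp] lemma localizationLift_toLocalization {S : Submonoid C} (f : C ⟶ E)
    (hf : ∀ s ∈ S, IsUnit (f.toMonoidHom s)) (c : C) :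
    (localizationLift f hf).toMonoidHom ((C.toLocalization S).toMonoidHom c) =
      f.toMonoidHom c :=
  (C.isLocalizationMap_localizationMap S).liftWithZero_apply f.toMonoidHom hf c

/-- A morphism of blueprints is a localization at `S` if it inverts `S`, if all elements of its
target are fractions with denominators in `S`, and if additive relations in the target come from
additive relations in the source after multiplication with an element of `S`. -/
structure IsLocalizationHom (S : Submonoid C) (f : C ⟶ D) : Prop where
  isUnit : ∀ s ∈ S, IsUnit (f.toMonoidHom s)
  surj : ∀ d : D, ∃ s ∈ S, ∃ c : C, f.toMonoidHom s * d = f.toMonoidHom c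
  exists_rel : ∀ x y : FormalSum C, D.rel (FormalSum.map f.toMonoidHom x)
    (FormalSum.map f.toMonoidHom y) → ∃ s ∈ S, C.rel (FormalSum.of s * x) (FormalSum.of s * y)

namespace IsLocalizationHom

variable {S : Submonoid C} {f : C ⟶ D}

/-- Equality of elements is the additive relation between one-term sums, so `exists_rel` also
controls the underlying monoids. -/
lemma exists_of_eq (hf : IsLocalizationHom S f) {a b : C}
    (h : f.toMonoidHom a = f.toMonoidHom b) : ∃ s ∈ S, s * a = s * b := by
  obtain ⟨s, hs, hr⟩ := hf.exists_rel (FormalSum.of a) (FormalSum.of b) (by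
    rw [FormalSum.map_of, FormalSum.map_of, h]
    exact RingCon.refl _ _)
  rw [← map_mul, ← map_mul] at hr
  exact ⟨s, hs, C.eq_of_rel _ _ hr⟩

/-- Clearing denominators in a formal sum, while keeping the numerators in `P`. Passing to a common
denominator multiplies numerators by elements of `S`, whence `hP`. The cases used are `P = Set.univ`
and `P` a prime ideal. -/
lemma exists_map_eq {P : Set C} (hP : ∀ s ∈ S, ∀ c ∈ P, s * c ∈ P)
    {X : FormalSum D} (hX : X ∈ AddSubmonoid.closure
      (FormalSum.of '' {d : D | ∃ s ∈ S, ∃ c ∈ P, f.toMonoidHom s * d = f.toMonoidHom c} :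
        Set (FormalSum D))) :
    ∃ s ∈ S, ∃ x ∈ AddSubmonoid.closure (FormalSum.of '' P : Set (FormalSum C)),
      FormalSum.map f.toMonoidHom x = FormalSum.of (f.toMonoidHom s) * X := by
  induction hX using AddSubmonoid.closure_induction with
  | mem y hy =>
    obtain ⟨d, ⟨s, hs, c, hc, h⟩, rfl⟩ := hy
    refine ⟨s, hs, FormalSum.of c, AddSubmonoid.subset_closure (Set.mem_image_of_mem _ hc), ?_⟩
    rw [FormalSum.map_of, ← map_mul, h]
  | zero => exact ⟨1, one_mem _, 0, zero_mem _, by rw [map_zero, mul_zero]⟩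
  | add y z _ _ hy hz =>
    obtain ⟨s, hs, x, hx, h⟩ := hy
    obtain ⟨t, ht, w, hw, k⟩ := hz
    refine ⟨s * t, mul_mem hs ht, FormalSum.of t * x + FormalSum.of s * w,
      add_mem (FormalSum.of_mul_mem_closure (hP t ht) hx)
        (FormalSum.of_mul_mem_closure (hP s hs) hw), ?_⟩
    rw [map_add, map_mul, map_mul, h, k, FormalSum.map_of, FormalSum.map_of,
      map_mul f.toMonoidHom, map_mul FormalSum.of]
    ring

lemma exists_map_eq' (hf : IsLocalizationHom S f) (X : FormalSum D) :
    ∃ s ∈ S, ∃ x : FormalSum C,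
      FormalSum.map f.toMonoidHom x = FormalSum.of (f.toMonoidHom s) * X := by
  obtain ⟨s, hs, x, -, h⟩ := exists_map_eq (f := f) (P := Set.univ) (fun _ _ _ _ => trivial) (X := X)
    ((FormalSum.mem_closure_of_iff _ _).mpr fun d _ => by
      obtain ⟨s, hs, c, h⟩ := hf.surj d
      exact ⟨s, hs, c, trivial, h⟩)
  exact ⟨s, hs, x, h⟩

/-- A morphism out of a localization reflects additive relations if it does so for additive
relations between elements of the source. -/
lemma rel_of_map_rel (hf : IsLocalizationHom S f) (g : D ⟶ E)
    (h : ∀ x y : FormalSum C,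
      E.rel (FormalSum.map g.toMonoidHom (FormalSum.map f.toMonoidHom x))
        (FormalSum.map g.toMonoidHom (FormalSum.map f.toMonoidHom y)) →
      D.rel (FormalSum.map f.toMonoidHom x) (FormalSum.map f.toMonoidHom y))
    {X Y : FormalSum D} (hXY : E.rel (FormalSum.map g.toMonoidHom X)
      (FormalSum.map g.toMonoidHom Y)) : D.rel X Y := by
  obtain ⟨s, hs, x, hx⟩ := hf.exists_map_eq' X
  obtain ⟨t, ht, y, hy⟩ := hf.exists_map_eq' Y
  have hX : FormalSum.map f.toMonoidHom (FormalSum.of t * x) =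
      FormalSum.of (f.toMonoidHom (s * t)) * X := by
    rw [map_mul, hx, FormalSum.map_of, map_mul f.toMonoidHom, map_mul FormalSum.of]; ring
  have hY : FormalSum.map f.toMonoidHom (FormalSum.of s * y) =
      FormalSum.of (f.toMonoidHom (s * t)) * Y := by
    rw [map_mul, hy, FormalSum.map_of, map_mul f.toMonoidHom, map_mul FormalSum.of]; ring
  -- After multiplication by the unit `f (s * t)` both sums come from `C`, where `h` applies.
  refine D.rel_of_isUnit_mul (hf.isUnit (s * t) (mul_mem hs ht)) ?_
  rw [← hX, ← hY]
  apply h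
  rw [hX, hY, map_mul (FormalSum.map _), map_mul (FormalSum.map _), FormalSum.map_of]
  exact E.rel_of_mul _ hXY

/-- A morphism with the first two properties of a localization, through which the canonical
morphism `C → S⁻¹C` factors, is a localization. -/
lemma of_factorization {S : Submonoid C} {f : C ⟶ D} {C' : Blueprint.{u}} {l : C ⟶ C'}
    (hl : IsLocalizationHom S l) (isUnit : ∀ s ∈ S, IsUnit (f.toMonoidHom s))
    (surj : ∀ d : D, ∃ s ∈ S, ∃ c : C, f.toMonoidHom s * d = f.toMonoidHom c)
    (g : D ⟶ C') (hg : f ≫ g = l) : IsLocalizationHom S f := by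
  refine ⟨isUnit, surj, fun x y h => hl.exists_rel x y ?_⟩
  subst hg
  have := g.map_rel _ _ h
  rw [← FormalSum.map_comp, ← FormalSum.map_comp] at this
  exact this

end IsLocalizationHom

/-- The canonical morphism `C → S⁻¹C` is a localization. -/
lemma isLocalizationHom_toLocalization (S : Submonoid C) :
    IsLocalizationHom S (C.toLocalization S) where
  isUnit s hs := isUnit_toLocalization hs
  surj d := by
    induction d using Localization.ind with
    | _ p => exact ⟨p.2, p.2.2, p.1, mk_mul_toLocalization p.1 p.2⟩
  exists_rel x y h := by
    -- The relation becomes an equality in the localization of the semiring `ℕ[A]/R` at the image of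
    -- `S`. There, two images agree exactly when they agree after multiplication by some `s ∈ S`.
    have h' := C.localizationRel_compare S h
    have key : ∀ z : FormalSum C, FormalSum.eval (C.localizationCompare S)
        (FormalSum.map (C.localizationMap S) z) =
        algebraMap (ConQuotient C.rel) (Localization (S.map C.toSemiring))
          (ConQuotient.mk C.rel z) := by
      intro z
      have key : (C.localizationCompare S).comp (C.localizationMap S : C →* Localization S) =
          ((algebraMap (ConQuotient C.rel) (Localization (S.map C.toSemiring)) :
            ConQuotient C.rel →+* _) : ConQuotient C.rel →* _).comp C.toSemiring := by
        ext a
        exact C.localizationCompare_mk_one S a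
      rw [FormalSum.eval_map, key, ← FormalSum.comp_eval, C.eval_toSemiring]
    erw [key, key] at h'
    rw [IsLocalization.eq_iff_exists (S.map C.toSemiring)] at h'
    obtain ⟨⟨_, s, hs, rfl⟩, h'⟩ := h'
    refine ⟨s, hs, (ConQuotient.mk_eq_iff C.rel).mp ?_⟩
    rw [map_mul, map_mul]
    exact h'

/-! ### Monoid blueprints: universal property and localization -/

section MonoidBlueprint

variable {M N : Type u} [CommMonoidWithZero M] [CommMonoidWithZero N]

/-- The inclusion `M → B[M]`, `m ↦ 1 ∧ m`. -/
def monomial (B : Blueprint.{u}) (M : Type u) [CommMonoidWithZero M] :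
    M →*₀ B.monoidBlueprint M where
  toFun m := Smash.mk (1 : B) m
  map_zero' := Smash.mk_eq_iff.mpr (Or.inr ⟨Or.inr rfl, Or.inr rfl⟩)
  map_one' := rfl
  map_mul' m n := (congrArg (fun b : B => Smash.mk b (m * n)) (one_mul (1 : B)).symm).trans
    (Smash.mk_mul _ _ _ _).symm

lemma toMonoidBlueprint_mul_monomial (b : B) (m : M) :
    ((B.toMonoidBlueprint M).toMonoidHom b * B.monomial M m : B.monoidBlueprint M) =
      (Smash.mk b m : Smash B M) := by
  refine (Smash.mk_mul _ _ _ _).trans ?_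
  rw [one_mul, mul_one]

/-- The morphism `B[M] → E` induced by a morphism `B → E` and a morphism of monoids `M → E`. -/
def monoidBlueprintLift (f : B ⟶ E) (g : M →*₀ E) : B.monoidBlueprint M ⟶ E :=
  let k : Smash B M →*₀ E :=
    { toFun := Quotient.lift (fun p : B × M => f.toMonoidHom p.1 * g p.2) (by
        have hz : ∀ p : B × M, (p.1 = 0 ∨ p.2 = 0) → f.toMonoidHom p.1 * g p.2 = 0 := by
          rintro p (h | h) <;> simp [h]
        rintro p q (rfl | ⟨h1, h2⟩)
        · rfl
        · exact (hz p h1).trans (hz q h2).symm)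
      map_zero' := by
        change f.toMonoidHom 0 * g 0 = 0
        rw [map_zero, zero_mul]
      map_one' := by
        change f.toMonoidHom 1 * g 1 = 1
        rw [map_one, map_one, one_mul]
      map_mul' := fun z w => by
        induction z using Smash.ind with
        | _ a m =>
          induction w using Smash.ind with
          | _ b n =>
            change f.toMonoidHom (a * b) * g (m * n) =
              (f.toMonoidHom a * g m) * (f.toMonoidHom b * g n)
            rw [map_mul, map_mul, mul_mul_mul_comm] }
  { toMonoidHom := k
    map_rel := fun x y h => by
      have hle : B.monoidBlueprintRel M ≤ E.rel.comap (FormalSum.map k) := by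
        refine RingCon.ringConGen_le.mpr ?_
        rintro X Y ⟨x, y, hxy, rfl, rfl⟩
        change E.rel _ _
        have hc : k.comp (Smash.inl B M) = f.toMonoidHom := by
          ext b
          change f.toMonoidHom b * g 1 = _
          rw [map_one, mul_one]
        rw [← FormalSum.map_comp, ← FormalSum.map_comp, hc]
        exact f.map_rel _ _ hxy
      exact hle h }

lemma monoidBlueprintLift_mk (f : B ⟶ E) (g : M →*₀ E) (b : B) (m : M) :
    (monoidBlueprintLift f g).toMonoidHom (Smash.mk b m : Smash B M) =
      f.toMonoidHom b * g m := rfl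

/-- The morphism `B[M] → B[S⁻¹M]` is the localization of `B[M]` at `S`. -/
lemma isLocalizationHom_monoidBlueprintMap (S : Submonoid M) (l : M →*₀ N)
    (hl : S.IsLocalizationMap l) :
    IsLocalizationHom (S.map (B.monomial M)) (B.monoidBlueprintMap l) := by
  have key : ∀ (m : M) (b : B) (n : N),
      Smash.mk (1 : B) (l m) * Smash.mk b n = Smash.mk b (n * l m) := by
    intro m b n
    refine (Smash.mk_mul _ _ _ _).trans ?_
    rw [one_mul, mul_comm]
  let C' := (B.monoidBlueprint M).localization (S.map (B.monomial M))
  let q := (B.monoidBlueprint M).toLocalization (S.map (B.monomial M))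
  have hq : ∀ s ∈ S, IsUnit (q.toMonoidHom.comp (B.monomial M) s) := fun s hs =>
    isUnit_toLocalization (Submonoid.mem_map_of_mem _ hs)
  -- The universal properties of `B[·]` and of `S⁻¹M` give a morphism from `B[S⁻¹M]` to the
  -- localization of `B[M]` at `S`. Relations in `B[S⁻¹M]` are pushed there, where denominators can
  -- be cleared.
  refine (isLocalizationHom_toLocalization _).of_factorization ?_ ?_
    (monoidBlueprintLift (B.toMonoidBlueprint M ≫ q)
      (hl.liftWithZero (q.toMonoidHom.comp (B.monomial M)) hq)) ?_
  · rintro _ ⟨s, hs, rfl⟩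
    exact (hl.map_units ⟨s, hs⟩).map (B.monomial N)
  · intro d
    induction d using Smash.ind with
    | _ b n =>
      obtain ⟨⟨m, s⟩, h⟩ := hl.surj n
      refine ⟨_, Submonoid.mem_map_of_mem _ s.2, (Smash.mk b m : Smash B M), ?_⟩
      refine (key s b n).trans ?_
      exact congrArg (Smash.mk b) h
  · refine hom_ext fun c => ?_
    induction c using Smash.ind with
    | _ b m =>
      refine (monoidBlueprintLift_mk _ _ b (l m)).trans ?_
      rw [hl.liftWithZero_apply]
      exact (map_mul q.toMonoidHom _ _).symm.trans
        (congrArg q.toMonoidHom (toMonoidBlueprint_mul_monomial b m))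

end MonoidBlueprint

/-! ### Prime ideals, basic open sets and maps between local blueprints -/

namespace PrimeIdeal

lemma mem_of_rel' (p : PrimeIdeal C) {x y : FormalSum C} {c : C}
    (hx : x ∈ AddSubmonoid.closure (FormalSum.of '' p.carrier : Set (FormalSum C)))
    (hy : y ∈ AddSubmonoid.closure (FormalSum.of '' p.carrier : Set (FormalSum C)))
    (h : C.rel (x + FormalSum.of c) y) : c ∈ p.carrier :=
  p.mem_of_rel x y c ((FormalSum.mem_closure_of_iff _ _).mp hx)
    ((FormalSum.mem_closure_of_iff _ _).mp hy) h

lemma mul_mem_right (p : PrimeIdeal C) (a : C) {b : C} (hb : b ∈ p.carrier) :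
    a * b ∈ p.carrier :=
  mul_comm b a ▸ p.mul_mem b a hb

lemma notMem_of_isUnit (p : PrimeIdeal C) {a : C} (ha : IsUnit a) : a ∉ p.carrier := by
  intro h
  obtain ⟨b, hb⟩ := ha.exists_right_inv
  exact p.one_notMem (hb ▸ p.mul_mem a b h)

lemma mul_mem_iff (p : PrimeIdeal C) {a b : C} (ha : a ∉ p.carrier) :
    a * b ∈ p.carrier ↔ b ∈ p.carrier :=
  ⟨fun h => (p.mem_or_mem a b h).resolve_left ha, p.mul_mem_right a⟩

/-- The inverse image of a prime ideal. -/
def comap (f : C ⟶ D) (q : PrimeIdeal D) : PrimeIdeal C where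
  carrier := {c | f.toMonoidHom c ∈ q.carrier}
  zero_mem := by
    change f.toMonoidHom 0 ∈ q.carrier
    rw [map_zero]
    exact q.zero_mem
  mul_mem a b ha := by
    change f.toMonoidHom (a * b) ∈ q.carrier
    rw [map_mul]
    exact q.mul_mem _ _ ha
  mem_of_rel x y c hx hy h := by
    have h' := f.map_rel _ _ h
    rw [map_add (FormalSum.map _), FormalSum.map_of] at h'
    exact q.mem_of_rel'
      (FormalSum.map_mem_closure _ (fun _ h => h) ((FormalSum.mem_closure_of_iff _ _).mpr hx))
      (FormalSum.map_mem_closure _ (fun _ h => h) ((FormalSum.mem_closure_of_iff _ _).mpr hy)) h'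
  one_notMem := by
    change f.toMonoidHom 1 ∉ q.carrier
    rw [map_one]
    exact q.one_notMem
  mem_or_mem a b h := by
    change f.toMonoidHom (a * b) ∈ q.carrier at h
    rw [map_mul] at h
    exact q.mem_or_mem _ _ h

lemma mem_comap (f : C ⟶ D) (q : PrimeIdeal D) (c : C) :
    c ∈ (q.comap f).carrier ↔ f.toMonoidHom c ∈ q.carrier := Iff.rfl

lemma isOpen_basicOpen (h : C) : IsOpen (basicOpen h) :=
  TopologicalSpace.isOpen_generateFrom_of_mem ⟨h, rfl⟩

lemma continuous_comap (f : C ⟶ D) : Continuous (comap f) := by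
  refine continuous_generateFrom_iff.mpr ?_
  rintro _ ⟨h, rfl⟩
  exact isOpen_basicOpen (f.toMonoidHom h)

lemma basicOpen_mul (g h : C) : basicOpen (g * h) = basicOpen g ∩ basicOpen h := by
  ext p
  exact ⟨fun hp => ⟨fun hg => hp (p.mul_mem _ _ hg), fun hh => hp (p.mul_mem_right _ hh)⟩,
    fun hp h' => (p.mem_or_mem _ _ h').elim hp.1 hp.2⟩

/-- The generating sets are closed under finite intersections: `D(g) ∩ D(h) = D(gh)`, and `D(1)` is
the whole space. -/
lemma isTopologicalBasis_basicOpen :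
    IsTopologicalBasis (Set.range (basicOpen : C → Set (PrimeIdeal C))) where
  exists_subset_inter := by
    rintro _ ⟨g, rfl⟩ _ ⟨h, rfl⟩ p hp
    exact ⟨_, ⟨g * h, rfl⟩, (basicOpen_mul g h).symm ▸ hp, (basicOpen_mul g h).le⟩
  sUnion_eq := Set.eq_univ_of_forall fun p => ⟨_, ⟨1, rfl⟩, p.one_notMem⟩
  eq_generateFrom := rfl

/-- The canonical morphism `C → C_p`. -/
def toLocalizationAt (p : PrimeIdeal C) : C ⟶ p.localizationAt := C.toLocalization p.compl

lemma isLocalizationHom_toLocalizationAt (p : PrimeIdeal C) :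
    IsLocalizationHom p.compl p.toLocalizationAt :=
  isLocalizationHom_toLocalization p.compl

lemma toLocalizationAt_mul_frac (p : PrimeIdeal C) (a s : C) (hs : s ∉ p.carrier) :
    p.toLocalizationAt.toMonoidHom s * p.frac a s hs = p.toLocalizationAt.toMonoidHom a :=
  mk_mul_toLocalization (S := p.compl) a ⟨s, hs⟩

lemma isUnit_toLocalizationAt (p : PrimeIdeal C) {s : C} (hs : s ∉ p.carrier) :
    IsUnit (p.toLocalizationAt.toMonoidHom s) :=
  isUnit_toLocalization (S := p.compl) hs

/-- The morphism of localizations `C_p → D_q` for `p = f⁻¹(q)`. -/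
def localMap (f : C ⟶ D) {p : PrimeIdeal C} {q : PrimeIdeal D} (h : p = q.comap f) :
    p.localizationAt ⟶ q.localizationAt :=
  localizationLift (f ≫ q.toLocalizationAt) fun s hs =>
    q.isUnit_toLocalizationAt (by subst h; exact hs)

lemma localMap_toLocalizationAt (f : C ⟶ D) {p : PrimeIdeal C} {q : PrimeIdeal D}
    (h : p = q.comap f) (c : C) : (localMap f h).toMonoidHom (p.toLocalizationAt.toMonoidHom c) =
      q.toLocalizationAt.toMonoidHom (f.toMonoidHom c) :=
  localizationLift_toLocalization _ _ c

lemma localMap_frac (f : C ⟶ D) {p : PrimeIdeal C} {q : PrimeIdeal D} (h : p = q.comap f)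
    (a s : C) (hs : s ∉ p.carrier) (hs' : f.toMonoidHom s ∉ q.carrier) :
    (localMap f h).toMonoidHom (p.frac a s hs) =
      q.frac (f.toMonoidHom a) (f.toMonoidHom s) hs' := by
  refine (q.isUnit_toLocalizationAt hs').mul_left_cancel ?_
  rw [toLocalizationAt_mul_frac, ← localMap_toLocalizationAt f h, ← map_mul,
    toLocalizationAt_mul_frac, localMap_toLocalizationAt]

lemma frac_eq_frac {p : PrimeIdeal C} {a b s t : C} (hs : s ∉ p.carrier) (ht : t ∉ p.carrier)
    {u : C} (hu : u ∉ p.carrier) (h : u * (t * a) = u * (s * b)) :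
    p.frac a s hs = p.frac b t ht := by
  refine Localization.mk_eq_mk_iff.mpr (Localization.r_iff_exists.mpr ⟨⟨u, hu⟩, ?_⟩)
  exact h

end PrimeIdeal

open PrimeIdeal

/-! ### The spectrum of a localization: points, topology and local blueprints -/

namespace IsLocalizationHom

variable {S : Submonoid C} {f : C ⟶ D}

lemma comap_notMem (hf : IsLocalizationHom S f) (q : PrimeIdeal D) {s : C} (hs : s ∈ S) :
    f.toMonoidHom s ∉ q.carrier := q.notMem_of_isUnit (hf.isUnit s hs)

/-- An element of `D` differs from the image of its numerator by a unit, so a prime ideal of `D` is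
determined by the numerators it contains. -/
lemma comap_injective (hf : IsLocalizationHom S f) : Function.Injective (comap f) := by
  have key : ∀ q r : PrimeIdeal D, comap f q = comap f r → q.carrier ⊆ r.carrier := by
    intro q r h d hd
    obtain ⟨s, hs, c, hc⟩ := hf.surj d
    rw [← r.mul_mem_iff (hf.comap_notMem r hs), hc, ← mem_comap, ← h, mem_comap, ← hc]
    exact q.mul_mem_right _ hd
  exact fun q r h => PrimeIdeal.ext ((key q r h).antisymm (key r q h.symm))

/-- The prime ideal over `p` consists of the fractions that have a numerator in `p`. -/
lemma exists_comap_eq (hf : IsLocalizationHom S f) (p : PrimeIdeal C)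
    (hp : ∀ s ∈ S, s ∉ p.carrier) : ∃ q : PrimeIdeal D, q.comap f = p := by
  let I : Set D := {d | ∃ s ∈ S, ∃ c ∈ p.carrier, f.toMonoidHom s * d = f.toMonoidHom c}
  -- Membership in `I` does not depend on the chosen fraction: two numerators of `d` agree up to
  -- factors from `S`, which lie outside the prime `p`.
  have hI : ∀ (d : D), d ∈ I → ∀ s ∈ S, ∀ c, f.toMonoidHom s * d = f.toMonoidHom c →
      c ∈ p.carrier := by
    rintro d ⟨s, hs, c, hc, h⟩ t ht b hb
    have : f.toMonoidHom (t * c) = f.toMonoidHom (s * b) := by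
      rw [map_mul, map_mul, ← h, ← hb, mul_left_comm]
    obtain ⟨u, hu, h'⟩ := hf.exists_of_eq this
    have : u * (s * b) ∈ p.carrier := h' ▸ p.mul_mem_right u (p.mul_mem_right t hc)
    rwa [p.mul_mem_iff (hp u hu), p.mul_mem_iff (hp s hs)] at this
  have hclo : ∀ X : FormalSum D, (∀ a ∈ X.coeff.support, a ∈ I) → ∃ s ∈ S,
      ∃ x ∈ AddSubmonoid.closure (FormalSum.of '' p.carrier : Set (FormalSum C)),
      FormalSum.map f.toMonoidHom x = FormalSum.of (f.toMonoidHom s) * X := fun X hX =>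
    exists_map_eq (fun s _ c hc => p.mul_mem_right s hc)
      ((FormalSum.mem_closure_of_iff _ _).mpr hX)
  refine ⟨{ carrier := I, zero_mem := ⟨1, one_mem _, 0, p.zero_mem, by simp⟩,
            mul_mem := ?_, mem_of_rel := ?_, one_notMem := ?_, mem_or_mem := ?_ }, ?_⟩
  · rintro a b ⟨s, hs, c, hc, h⟩
    obtain ⟨t, ht, e, he⟩ := hf.surj b
    refine ⟨s * t, mul_mem hs ht, c * e, p.mul_mem _ _ hc, ?_⟩
    rw [map_mul, map_mul, ← h, ← he, mul_mul_mul_comm]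
  · intro x y d hx hy h
    obtain ⟨s, hs, x', hx', hsx⟩ := hclo x hx
    obtain ⟨t, ht, y', hy', hty⟩ := hclo y hy
    obtain ⟨r, hr, c, hc⟩ := hf.surj d
    refine ⟨r, hr, c, ?_, hc⟩
    -- The common denominator `s * t * r` clears `x`, `y` and `d` at once. The relation then
    -- descends to `C` up to a factor `u ∈ S`, and the ideal property of `p` yields `u * (s * t * c)
    -- ∈ p`; the factors from `S` cancel since `p` is prime.
    have h1 := D.rel_of_mul (f.toMonoidHom (s * t * r)) h
    have e1 : FormalSum.of (f.toMonoidHom (s * t * r)) * (x + FormalSum.of d) =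
        FormalSum.map f.toMonoidHom
          (FormalSum.of (t * r) * x' + FormalSum.of (s * t * c)) := by
      rw [map_add (FormalSum.map _), map_mul (FormalSum.map _), hsx, FormalSum.map_of,
        FormalSum.map_of]
      simp only [map_mul, ← hc]
      ring
    have e2 : FormalSum.of (f.toMonoidHom (s * t * r)) * y =
        FormalSum.map f.toMonoidHom (FormalSum.of (s * r) * y') := by
      rw [map_mul (FormalSum.map _), hty, FormalSum.map_of]
      simp only [map_mul]
      ring
    rw [e1, e2] at h1
    obtain ⟨u, hu, h2⟩ := hf.exists_rel _ _ h1
    rw [mul_add, ← map_mul] at h2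
    have hcl : ∀ (a : C) {z : FormalSum C},
        z ∈ AddSubmonoid.closure (FormalSum.of '' p.carrier : Set (FormalSum C)) →
        FormalSum.of a * z ∈
          AddSubmonoid.closure (FormalSum.of '' p.carrier : Set (FormalSum C)) :=
      fun a z hz => FormalSum.of_mul_mem_closure (fun b hb => p.mul_mem_right a hb) hz
    have := p.mem_of_rel' (hcl u (hcl _ hx')) (hcl u (hcl _ hy')) h2
    rwa [p.mul_mem_iff (hp u hu), p.mul_mem_iff (hp _ (mul_mem hs ht))] at this
  · intro h
    exact p.one_notMem (hI 1 h 1 (one_mem _) 1 (by simp))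
  · intro a b h
    obtain ⟨s, hs, c, hc⟩ := hf.surj a
    obtain ⟨t, ht, e, he⟩ := hf.surj b
    have := hI _ h (s * t) (mul_mem hs ht) (c * e) (by
      rw [map_mul, map_mul, ← hc, ← he, mul_mul_mul_comm])
    exact (p.mem_or_mem _ _ this).imp (fun h => ⟨s, hs, c, h, hc⟩) (fun h => ⟨t, ht, e, h, he⟩)
  · ext c
    exact ⟨fun h => hI _ h 1 (one_mem _) c (by simp), fun h => ⟨1, one_mem _, c, h, by simp⟩⟩

/-- A prime ideal avoids all powers of `h` as soon as it avoids `h`. -/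
lemma range_comap {h : C} (hf : IsLocalizationHom (Submonoid.powers h) f) :
    Set.range (comap f) = basicOpen h := by
  ext p
  constructor
  · rintro ⟨q, rfl⟩
    exact hf.comap_notMem q (Submonoid.mem_powers h)
  · intro hp
    refine hf.exists_comap_eq p ?_
    rintro _ ⟨n, rfl⟩
    exact pow_mem (S := p.compl) hp n

/-- For a numerator `c` of `d`, the set `D(d)` is the preimage of `D(c)`. -/
lemma isInducing_comap (hf : IsLocalizationHom S f) : Topology.IsInducing (comap f) := by
  refine ⟨le_antisymm (continuous_comap f).le_induced ?_⟩
  refine le_generateFrom ?_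
  rintro _ ⟨d, rfl⟩
  obtain ⟨s, hs, c, hc⟩ := hf.surj d
  refine ⟨basicOpen c, isOpen_basicOpen c, ?_⟩
  ext q
  change f.toMonoidHom c ∉ q.carrier ↔ d ∉ q.carrier
  rw [← hc, q.mul_mem_iff (hf.comap_notMem q hs)]

lemma isOpenEmbedding_comap {h : C} (hf : IsLocalizationHom (Submonoid.powers h) f) :
    Topology.IsOpenEmbedding (comap f) :=
  ⟨⟨hf.isInducing_comap, hf.comap_injective⟩, hf.range_comap ▸ isOpen_basicOpen h⟩

/-- For sums coming from `C`, a relation in `D_q` holds in `D` after multiplication by some `t ∉ q`.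
Writing `f s * t = f c` moves this factor into `C`, and a further `u ∈ S` gives a relation in `C`
itself. The total factor `u * c` lies outside `p`, hence is a unit in `C_p`. -/
lemma rel_of_localMap_rel (hf : IsLocalizationHom S f) {p : PrimeIdeal C} {q : PrimeIdeal D}
    (h : p = q.comap f) {X Y : FormalSum p.localizationAt}
    (hXY : q.localizationAt.rel (FormalSum.map (localMap f h).toMonoidHom X)
      (FormalSum.map (localMap f h).toMonoidHom Y)) : p.localizationAt.rel X Y := by
  subst h
  refine (q.comap f).isLocalizationHom_toLocalizationAt.rel_of_map_rel
    (localMap f rfl) (fun x y h => ?_) hXY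
  have hl : (localMap f (rfl : q.comap f = _)).toMonoidHom.comp
      (q.comap f).toLocalizationAt.toMonoidHom =
      q.toLocalizationAt.toMonoidHom.comp f.toMonoidHom :=
    MonoidWithZeroHom.ext (localMap_toLocalizationAt f rfl)
  rw [← FormalSum.map_comp, ← FormalSum.map_comp, hl, FormalSum.map_comp,
    FormalSum.map_comp] at h
  obtain ⟨t, ht, h1⟩ := q.isLocalizationHom_toLocalizationAt.exists_rel _ _ h
  obtain ⟨s, hs, c, hc⟩ := hf.surj t
  have h2 := D.rel_of_mul (f.toMonoidHom s) h1
  rw [← mul_assoc, ← mul_assoc, ← map_mul FormalSum.of, hc, ← FormalSum.map_of,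
    ← map_mul, ← map_mul] at h2
  obtain ⟨u, hu, h3⟩ := hf.exists_rel _ _ h2
  rw [← mul_assoc, ← mul_assoc, ← map_mul FormalSum.of] at h3
  have h4 := (q.comap f).toLocalizationAt.map_rel _ _ h3
  rw [map_mul (FormalSum.map _), map_mul (FormalSum.map _), FormalSum.map_of] at h4
  refine rel_of_isUnit_mul _ ((q.comap f).isUnit_toLocalizationAt ?_) h4
  refine (q.comap f).compl.mul_mem (hf.comap_notMem q hu) ?_
  change f.toMonoidHom c ∉ q.carrier
  rw [← hc, q.mul_mem_iff (hf.comap_notMem q hs)]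
  exact ht

lemma localMap_injective (hf : IsLocalizationHom S f) {p : PrimeIdeal C} {q : PrimeIdeal D}
    (h : p = q.comap f) : Function.Injective (localMap f h).toMonoidHom := fun a b hab =>
  p.localizationAt.eq_of_rel a b (hf.rel_of_localMap_rel h (by
    rw [FormalSum.map_of, FormalSum.map_of, hab]
    exact RingCon.refl _ _))

/-- Fractions in `D` come from fractions in `C`. -/
lemma exists_frac (hf : IsLocalizationHom S f) (a b : D) :
    ∃ c k : C, ∀ (p : PrimeIdeal C) (q : PrimeIdeal D) (h : p = q.comap f) (hb : b ∉ q.carrier),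
      ∃ hk : k ∉ p.carrier, (localMap f h).toMonoidHom (p.frac c k hk) = q.frac a b hb := by
  obtain ⟨s, hs, c, hc⟩ := hf.surj a
  obtain ⟨t, ht, k, hk⟩ := hf.surj b
  -- With `a = c/s` and `b = k/t` one has `a/b = tc/(sk)`. The same pair serves all `q` with `b ∉
  -- q`, which is what turns local fractions over `D` into local fractions over `C`.
  refine ⟨t * c, s * k, ?_⟩
  rintro _ q rfl hb
  have hsk : f.toMonoidHom (s * k) ∉ q.carrier := by
    rw [map_mul, q.mul_mem_iff (hf.comap_notMem q hs), ← hk,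
      q.mul_mem_iff (hf.comap_notMem q ht)]
    exact hb
  refine ⟨hsk, (localMap_frac f rfl _ _ _ hsk).trans ?_⟩
  refine frac_eq_frac _ _ q.one_notMem ?_
  rw [map_mul, map_mul, ← hc, ← hk]
  ac_rfl

end IsLocalizationHom

/-! ### Morphisms of spectra and pullback of sections -/

lemma rel_map_map_iff (E : Blueprint.{u}) {A A' : Type u} [CommMonoidWithZero A]
    [CommMonoidWithZero A'] (f : A →*₀ A') (g : A' →*₀ E) {x y : FormalSum A} :
    E.rel (FormalSum.map g (FormalSum.map f x)) (FormalSum.map g (FormalSum.map f y)) ↔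
      E.rel (FormalSum.map (g.comp f) x) (FormalSum.map (g.comp f) y) := by
  rw [FormalSum.map_comp, FormalSum.map_comp]

/-- The continuous map `Spec D → Spec C` induced by a morphism `C → D`. -/
def specTopMap (f : C ⟶ D) : D.specTop ⟶ C.specTop :=
  TopCat.ofHom ⟨comap f, continuous_comap f⟩

/-- The pullback of sections along `Spec D → Spec C`. -/
def Section.pullback (f : C ⟶ D) (U : Opens C.specTop) :
    Section U →*₀ Section ((Opens.map (specTopMap f)).obj U) where
  toFun s := ⟨fun q => (localMap f rfl).toMonoidHom (s.1 ⟨comap f q.1, q.2⟩), fun q => by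
    obtain ⟨V, hqV, hVU, a, g, k⟩ := s.2 ⟨comap f q.1, q.2⟩
    refine ⟨(Opens.map (specTopMap f)).obj V, hqV, fun x hx => hVU hx, f.toMonoidHom a,
      f.toMonoidHom g, fun r => ?_⟩
    obtain ⟨hg, hr⟩ := k ⟨comap f r.1, r.2⟩
    exact ⟨hg, (congrArg (localMap f rfl).toMonoidHom hr).trans (localMap_frac f rfl a g hg hg)⟩⟩
  map_zero' := Section.ext fun _ => map_zero (localMap f rfl).toMonoidHom
  map_one' := Section.ext fun _ => map_one (localMap f rfl).toMonoidHom
  map_mul' _ _ := Section.ext fun _ => map_mul (localMap f rfl).toMonoidHom _ _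

/-- The pullback of sections along `Spec D → Spec C` as a morphism of blueprints. -/
def sectionMap (f : C ⟶ D) (U : Opens C.specTop) :
    sectionBlueprint U ⟶ sectionBlueprint ((Opens.map (specTopMap f)).obj U) where
  toMonoidHom := Section.pullback f U
  map_rel x y h := by
    refine (sectionBlueprint_rel_iff _ _).mpr fun q => ?_
    have hq := (sectionBlueprint_rel_iff _ _).mp h ⟨comap f q.1, q.2⟩
    exact (rel_map_map_iff _ (Section.pullback f U) (Section.germ _ q)).mpr
      ((rel_map_map_iff _ (Section.germ U ⟨comap f q.1, q.2⟩) (localMap f rfl).toMonoidHom).mp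
        ((localMap f rfl).map_rel _ _ hq))

/-- The morphism `Spec D → Spec C` induced by a morphism `C → D`. -/
def specMap (f : C ⟶ D) : D.spec ⟶ C.spec :=
  InducedCategory.homMk
    { base := specTopMap f
      c := { app := fun U => sectionMap f U.unop
             naturality := fun _ _ _ => rfl } }

lemma toGlobalSections_specMap (f : C ⟶ D) :
    C.toGlobalSections ≫ (specMap f).hom.c.app (op ⊤) = f ≫ D.toGlobalSections := by
  refine hom_ext fun c => Section.ext fun q => ?_
  refine (localMap_frac f rfl c 1 (one_notMem _) ?_).trans ?_
  · rw [map_one]; exact q.1.one_notMem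
  · simp only [map_one]
    rfl

/-! ### Localizations at one element induce open immersions -/

namespace IsLocalizationHom

variable {S : Submonoid C} {f : C ⟶ D}

lemma pullback_injective (hf : IsLocalizationHom S f) {U : Opens C.specTop}
    (hU : ∀ p ∈ U, ∃ q : PrimeIdeal D, comap f q = p) :
    Function.Injective (Section.pullback f U) := by
  intro s t h
  refine Section.ext ?_
  rintro ⟨p, hp⟩
  obtain ⟨q, rfl⟩ := hU p hp
  exact hf.localMap_injective rfl (congrFun (congrArg Subtype.val h) ⟨q, hp⟩)

/-- Each value of `t` lifts to `C_p` by lifting a fraction that represents it. The lifts form a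
section because a representing fraction is valid on an open `V`, whose image under `comap f` is
open. -/
lemma pullback_surjective (hf : IsLocalizationHom S f) (hopen : IsOpenMap (comap f))
    {U : Opens C.specTop} (hU : ∀ p ∈ U, ∃ q : PrimeIdeal D, comap f q = p) :
    Function.Surjective (Section.pullback f U) := by
  intro t
  -- Quantifying over every `q` with an equation `p = comap f q`, although `q` is unique, avoids
  -- transporting values between different localizations.
  have hval : ∀ p : U, ∃ z : localizationAt (B := C) p.1, ∀ (q : PrimeIdeal D)
      (h : p.1 = comap f q), (localMap f h).toMonoidHom z =
        t.1 ⟨q, show comap f q ∈ U from h ▸ p.2⟩ := by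
    rintro ⟨p, hp⟩
    obtain ⟨q, rfl⟩ := hU p hp
    obtain ⟨V, hqV, hVU, a, b, k⟩ := t.2 ⟨q, hp⟩
    obtain ⟨c, d, hcd⟩ := hf.exists_frac a b
    obtain ⟨hb, h1⟩ := k ⟨q, hqV⟩
    obtain ⟨hd, h2⟩ := hcd _ q rfl hb
    refine ⟨frac _ c d hd, fun r hr => ?_⟩
    obtain rfl := hf.comap_injective hr
    exact h2.trans h1.symm
  choose z hz using hval
  refine ⟨⟨z, ?_⟩, Section.ext fun q => hz ⟨comap f q.1, q.2⟩ q.1 rfl⟩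
  rintro ⟨p, hp⟩
  obtain ⟨q, rfl⟩ := hU p hp
  obtain ⟨V, hqV, hVU, a, b, k⟩ := t.2 ⟨q, hp⟩
  obtain ⟨c, d, hcd⟩ := hf.exists_frac a b
  refine ⟨⟨comap f '' V.1, hopen _ V.2⟩, ⟨q, hqV, rfl⟩, ?_, c, d, ?_⟩
  · rintro _ ⟨r, hr, rfl⟩
    exact hVU hr
  · rintro ⟨_, r, hr, rfl⟩
    obtain ⟨hb, h1⟩ := k ⟨r, hr⟩
    obtain ⟨hd, h2⟩ := hcd _ r rfl hb
    refine ⟨hd, hf.localMap_injective rfl (Eq.trans ?_ (h1.trans h2.symm))⟩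
    exact hz ⟨comap f r, hVU hr⟩ r rfl

/-- Relations between sections are tested pointwise, so `rel_of_localMap_rel` at each point of `U`
shows that they are reflected. -/
lemma isIso_sectionMap (hf : IsLocalizationHom S f) (hopen : IsOpenMap (comap f))
    {U : Opens C.specTop} (hU : ∀ p ∈ U, ∃ q : PrimeIdeal D, comap f q = p) :
    IsIso (sectionMap f U) := by
  refine isIso_of_bijective _ ⟨hf.pullback_injective hU, hf.pullback_surjective hopen hU⟩
    fun x y h => (sectionBlueprint_rel_iff x y).mpr ?_
  rintro ⟨p, hp⟩
  obtain ⟨q, rfl⟩ := hU p hp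
  have h1 : (localizationAt q).rel _ _ := (rel_map_map_iff _ (Section.pullback f U)
    (Section.germ ((Opens.map (specTopMap f)).obj U) ⟨q, hp⟩)).mp
    ((sectionBlueprint_rel_iff _ _).mp h ⟨q, hp⟩)
  exact hf.rel_of_localMap_rel rfl
    ((rel_map_map_iff _ (Section.germ U ⟨comap f q, hp⟩) (localMap f rfl).toMonoidHom).mpr h1)

/-- The morphism `Spec C[h⁻¹] → Spec C` is an open immersion. -/
lemma isOpenImmersion_specMap {h : C} (hf : IsLocalizationHom (Submonoid.powers h) f) :
    SheafedSpace.IsOpenImmersion (specMap f) where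
  base_open := hf.isOpenEmbedding_comap
  c_iso U := hf.isIso_sectionMap hf.isOpenEmbedding_comap.isOpenMap (by
    rintro _ ⟨q, -, rfl⟩
    exact ⟨q, rfl⟩)

end IsLocalizationHom

end Blueprint

/-! ### Open subspaces, open immersions and coordinate maps -/

/-- The inclusion of an open subspace. -/
def openSubspaceInclusion (X : SheafedSpace Blueprint.{u}) (U : Opens X) :
    openSubspace X U ⟶ X :=
  X.ofRestrict U.isOpenEmbedding

instance (X : SheafedSpace Blueprint.{u}) (U : Opens X) :
    SheafedSpace.IsOpenImmersion (openSubspaceInclusion X U) :=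
  PresheafedSpace.IsOpenImmersion.ofRestrict X.toPresheafedSpace U.isOpenEmbedding

lemma range_openSubspaceInclusion (X : SheafedSpace Blueprint.{u}) (U : Opens X) :
    Set.range (openSubspaceInclusion X U).hom.base = U :=
  Subtype.range_coe

/-- The open subspace `W` is isomorphic to the source of an open immersion with image `W`. -/
def openSubspaceIsoOfRangeEq {X Y : SheafedSpace Blueprint.{u}} (j : Y ⟶ X)
    [SheafedSpace.IsOpenImmersion j] (W : Opens X) (hW : Set.range j.hom.base = W) :
    openSubspace X W ≅ Y :=
  SheafedSpace.isoMk (PresheafedSpace.IsOpenImmersion.isoOfRangeEq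
    (openSubspaceInclusion X W).hom j.hom ((range_openSubspaceInclusion X W).trans hW.symm))

lemma openSubspaceIsoOfRangeEq_hom_comp {X Y : SheafedSpace Blueprint.{u}} (j : Y ⟶ X)
    [SheafedSpace.IsOpenImmersion j] (W : Opens X) (hW : Set.range j.hom.base = W) :
    (openSubspaceIsoOfRangeEq j W hW).hom ≫ j = openSubspaceInclusion X W :=
  InducedCategory.hom_ext (PresheafedSpace.IsOpenImmersion.lift_fac j.hom
    (openSubspaceInclusion X W).hom ((range_openSubspaceInclusion X W).trans hW.symm).le)

/-- The inclusion of `Spec D` into `X` for a morphism `C → D` and an open `U ≅ Spec C` of `X`. -/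
def specMapToScheme {X : SheafedSpace Blueprint.{u}} {U : Opens X} {C D : Blueprint.{u}}
    (e : openSubspace X U ≅ C.spec) (f : C ⟶ D) : D.spec ⟶ X :=
  Blueprint.specMap f ≫ e.inv ≫ openSubspaceInclusion X U

lemma specMapToScheme_mem {X : SheafedSpace Blueprint.{u}} {U : Opens X} {C D : Blueprint.{u}}
    (e : openSubspace X U ≅ C.spec) (f : C ⟶ D) (q : D.spec) :
    (specMapToScheme e f).hom.base q ∈ U :=
  (show U from e.inv.hom.base ((Blueprint.specMap f).hom.base q)).2

/-- The identification of sections over `Y` with sections over the open subspace `U ≅ Y`. -/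
def sectionsOfIso {X Y : SheafedSpace Blueprint.{u}} {U : Opens X} (e : openSubspace X U ≅ Y) :
    Y.presheaf.obj (op ⊤) ⟶ X.presheaf.obj (op U) :=
  e.hom.hom.c.app (op ⊤) ≫
    X.presheaf.map (homOfLE (show U ≤ U.isOpenEmbedding.functor.obj ⊤ from
      fun x hx => ⟨⟨x, hx⟩, trivial, rfl⟩)).op

instance {X Y : SheafedSpace Blueprint.{u}} {U : Opens X} (e : openSubspace X U ≅ Y) :
    IsIso (sectionsOfIso e) := by
  have h : U = U.isOpenEmbedding.functor.obj ⊤ :=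
    le_antisymm (fun x hx => ⟨⟨x, hx⟩, trivial, rfl⟩) (by rintro _ ⟨x, -, rfl⟩; exact x.2)
  have : IsIso (X.presheaf.map (homOfLE h.le).op) :=
    (X.presheaf.mapIso (eqToIso h).op).isIso_hom
  have : IsIso (e.hom.hom.c.app (op ⊤)) := by
    have : IsIso e.hom.hom.c := inferInstance
    infer_instance
  exact IsIso.comp_isIso' ‹_› ‹_›

/-- There is at most one inclusion between two opens, so every chain of restrictions with the same
ends gives the same map. -/
lemma presheaf_map_eq_comp₄ {T : TopCat} (F : TopCat.Presheaf Blueprint.{u} T)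
    {U₁ U₂ U₃ U₄ U₅ : (Opens T)ᵒᵖ} (a : U₁ ⟶ U₅) (b : U₁ ⟶ U₂) (c : U₂ ⟶ U₃) (d : U₃ ⟶ U₄)
    (e : U₄ ⟶ U₅) : F.map a = F.map b ≫ F.map c ≫ F.map d ≫ F.map e := by
  simp only [← Functor.map_comp]
  congr 1

/-- Restriction to `W` is pullback along the inclusion, which factors through `Y` by `h`. The
formula follows from naturality of the pullback along `e`. -/
lemma presheaf_map_eq_comp {X Y : SheafedSpace Blueprint.{u}} {U W : Opens X} (hWU : W ≤ U)
    (j : Y ⟶ X) (e : openSubspace X W ≅ Y) (h : e.hom ≫ j = openSubspaceInclusion X W)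
    (hU : ⊤ ≤ (Opens.map j.hom.base).obj U) :
    X.presheaf.map (homOfLE hWU).op =
      j.hom.c.app (op U) ≫ Y.presheaf.map (homOfLE hU).op ≫ sectionsOfIso e := by
  have h1 := SheafedSpace.congr_hom_app h (op U)
  rw [SheafedSpace.comp_hom_c_app] at h1
  have h2 := e.hom.hom.c.naturality (homOfLE hU).op
  rw [sectionsOfIso]
  erw [reassoc_of% h2, reassoc_of% h1]
  exact presheaf_map_eq_comp₄ X.presheaf _ _ _ _ _

/-- In the coordinates of the chart `e`, pullback along `Spec D → X` is the morphism `f`. -/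
lemma coordinateMap_comp_specMapToScheme {X : SheafedSpace Blueprint.{u}} {U : Opens X}
    {C D : Blueprint.{u}} (e : openSubspace X U ≅ C.spec) (f : C ⟶ D) :
    coordinateMap e ≫ (specMapToScheme e f).hom.c.app (op U) ≫
      D.spec.presheaf.map (homOfLE (show ⊤ ≤ (Opens.map (specMapToScheme e f).hom.base).obj U from
        fun q _ => specMapToScheme_mem e f q)).op =
      f ≫ D.toGlobalSections := by
  have hU : ⊤ ≤ (Opens.map (e.inv ≫ openSubspaceInclusion X U).hom.base).obj U :=
    fun q _ => (show U from e.inv.hom.base q).2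
  have h1 := presheaf_map_eq_comp le_rfl (e.inv ≫ openSubspaceInclusion X U) e
    (e.hom_inv_id_assoc _) hU
  -- Identifying sections over `Spec C` with sections over `U` and pulling them back again is the
  -- identity; this is checked after composing with the isomorphism `sectionsOfIso e`.
  have h2 : sectionsOfIso e ≫ (e.inv ≫ openSubspaceInclusion X U).hom.c.app (op U) ≫
      C.spec.presheaf.map (homOfLE hU).op = 𝟙 _ := by
    rw [← cancel_mono (sectionsOfIso e), Category.assoc, Category.assoc, ← h1]
    exact (congrArg (sectionsOfIso e ≫ ·) (X.presheaf.map_id _)).trans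
      ((Category.comp_id _).trans (Category.id_comp _).symm)
  have h3 := (Blueprint.specMap f).hom.c.naturality (homOfLE hU).op
  rw [← Blueprint.toGlobalSections_specMap]
  refine Eq.trans (congrArg (fun k => C.toGlobalSections ≫ sectionsOfIso e ≫
    (e.inv ≫ openSubspaceInclusion X U).hom.c.app (op U) ≫ k) h3.symm) ?_
  have h4 := congrArg (fun k => C.toGlobalSections ≫ k ≫
    (Blueprint.specMap f).hom.c.app (op ⊤)) h2
  simp only [Category.assoc, Category.id_comp] at h4
  exact h4

/-- Describes the coordinates on the smaller open `W` through those on `U`; from this the new chart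
inherits its compatibility with the structure morphism. -/
lemma comp_coordinateMap {X : SheafedSpace Blueprint.{u}} {U W : Opens X} (hWU : W ≤ U)
    {C D : Blueprint.{u}} (e : openSubspace X U ≅ C.spec) (f : C ⟶ D)
    (e' : openSubspace X W ≅ D.spec)
    (h : e'.hom ≫ specMapToScheme e f = openSubspaceInclusion X W) :
    f ≫ coordinateMap e' = coordinateMap e ≫ X.presheaf.map (homOfLE hWU).op := by
  rw [presheaf_map_eq_comp hWU _ e' h (fun q _ => specMapToScheme_mem e f q)]
  have := congrArg (· ≫ sectionsOfIso e') (coordinateMap_comp_specMapToScheme e f)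
  simp only [Category.assoc] at this
  exact this.symm

/-! ### Small monoid charts around a point -/

namespace BlueSchemeOver

variable {B : Blueprint.{u}} {X : BlueSchemeOver B}

lemma exists_monoidChart_of_mem (hB : B.IsBlueField) {U : Opens X.toSheafedSpace}
    (c : X.MonoidChart U) {V : Opens X.toSheafedSpace} {x : X.toSheafedSpace} (hxU : x ∈ U)
    (hxV : x ∈ V) :
    ∃ W : Opens X.toSheafedSpace, x ∈ W ∧ W ≤ V ∧ Nonempty (X.MonoidChart W) := by
  -- the point of `Spec B[M]` corresponding to `x` and a basic open neighbourhood in `V`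
  let φ : (B.monoidBlueprint c.M).spec ⟶ X.toSheafedSpace :=
    c.iso.inv ≫ openSubspaceInclusion X.toSheafedSpace U
  let p : Blueprint.PrimeIdeal (B.monoidBlueprint c.M) := c.iso.hom.hom.base ⟨x, hxU⟩
  have hp : φ.hom.base p = x := by
    have h : (c.iso.hom ≫ c.iso.inv).hom.base ⟨x, hxU⟩ = ⟨x, hxU⟩ := by
      rw [c.iso.hom_inv_id]; rfl
    exact congrArg Subtype.val h
  obtain ⟨_, ⟨h, rfl⟩, hph, hhV⟩ :=
    Blueprint.PrimeIdeal.isTopologicalBasis_basicOpen.exists_subset_of_mem_open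
      (show φ.hom.base p ∈ V from hp ▸ hxV)
      (V.2.preimage φ.hom.base.hom.continuous)
  -- it is of the form `D(1 ∧ m)`
  obtain ⟨m, hm⟩ : ∃ m : c.M, Blueprint.PrimeIdeal.basicOpen h =
      Blueprint.PrimeIdeal.basicOpen (B.monomial c.M m) := by
    induction h using Blueprint.Smash.ind with
    | _ b m =>
      -- If `b = 0` then `h = 0` lies in every prime ideal, contradicting `p ∈ D(h)`.
      have hb : b ≠ 0 := by
        rintro rfl
        refine hph ?_
        have : (Blueprint.Smash.mk 0 m : Blueprint.Smash B c.M) = 0 :=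
          Blueprint.Smash.mk_eq_iff.mpr (Or.inr ⟨Or.inl rfl, Or.inl rfl⟩)
        rw [this]
        exact p.zero_mem
      refine ⟨m, ?_⟩
      rw [← Blueprint.toMonoidBlueprint_mul_monomial]
      ext q
      -- Here the blue field hypothesis enters: `b` is a unit in `B`, so `b ∧ 1` is a unit in `B[M]`
      -- and lies in no prime ideal.
      exact not_congr (q.mul_mem_iff (q.notMem_of_isUnit
        (((hB b).mpr hb).map (B.toMonoidBlueprint c.M).toMonoidHom)))
  rw [hm] at hph hhV
  let N : Type u := Localization (Submonoid.powers m)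
  let l : c.M →*₀ N :=
    { toFun := fun a => Localization.mk a 1
      map_zero' := Localization.mk_zero 1
      map_one' := Localization.mk_one
      map_mul' := fun a b => by rw [Localization.mk_mul, one_mul] }
  have hl : (Submonoid.powers m).IsLocalizationMap l :=
    (Localization.monoidOf (Submonoid.powers m)).isLocalizationMap
  let f := B.monoidBlueprintMap l
  have hf : Blueprint.IsLocalizationHom (Submonoid.powers (B.monomial c.M m)) f := by
    have := Blueprint.isLocalizationHom_monoidBlueprintMap (B := B) _ l hl
    rwa [Submonoid.map_powers] at this
  let j := specMapToScheme c.iso f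
  have : SheafedSpace.IsOpenImmersion (Blueprint.specMap f) := hf.isOpenImmersion_specMap
  have hj : SheafedSpace.IsOpenImmersion j :=
    SheafedSpace.IsOpenImmersion.comp (Blueprint.specMap f) (c.iso.inv ≫ openSubspaceInclusion _ U)
  -- `W` is `D(1 ∧ m)` seen inside `X`; it is presented as the image of `Spec B[N]` so that the
  -- chart comes from the open immersion `j`.
  let W : Opens X.toSheafedSpace := ⟨Set.range j.hom.base, hj.base_open.isOpen_range⟩
  have hWU : W ≤ U := by
    rintro _ ⟨q, rfl⟩
    exact specMapToScheme_mem c.iso f q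
  refine ⟨W, ?_, ?_, ⟨⟨N, openSubspaceIsoOfRangeEq j W rfl, ?_⟩⟩⟩
  · rw [← hf.range_comap] at hph
    obtain ⟨q, hq⟩ := hph
    exact ⟨q, (congrArg φ.hom.base hq).trans hp⟩
  · rintro _ ⟨q, rfl⟩
    refine hhV (a := Blueprint.PrimeIdeal.comap f q) ?_
    rw [← hf.range_comap]
    exact ⟨q, rfl⟩
  -- Since `l 1 = 1`, the map `B → B[N]` factors through `B[M]`, and compatibility over `B` reduces
  -- to that of the chart `c`.
  · have h1 : B.toMonoidBlueprint N = B.toMonoidBlueprint c.M ≫ f :=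
      Blueprint.hom_ext fun b => (congrArg (Blueprint.Smash.mk b) (map_one l)).symm
    rw [h1, Category.assoc, comp_coordinateMap hWU c.iso f _
      (openSubspaceIsoOfRangeEq_hom_comp j W rfl), reassoc_of% c.compatible,
      ← X.presheaf.map_comp]
    rfl

end BlueSchemeOver

end

theorem mainTheorem7 (B : Blueprint.{u}) (hB : B.IsBlueField) (X : BlueSchemeOver B)
    (hX : X.IsMonoidal) (U : Opens X.toSheafedSpace) :
    ∃ (ι : Type u) (W : ι → Opens X.toSheafedSpace),
      (⨆ i, W i = U) ∧ ∀ i, Nonempty (X.MonoidChart (W i)) := by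
  obtain ⟨ι, V, c, hV, -⟩ := hX
  have h : ∀ x : U, ∃ W : Opens X.toSheafedSpace, x.1 ∈ W ∧ W ≤ U ∧
      Nonempty (X.MonoidChart W) := by
    intro x
    obtain ⟨i, hi⟩ := Opens.mem_iSup.mp (hV ▸ Opens.mem_top x.1 : x.1 ∈ ⨆ i, V i)
    exact BlueSchemeOver.exists_monoidChart_of_mem hB (c i) hi x.2
  choose W hxW hWU hW using h
  -- The covering is indexed by the points of `U`, one chart around each.
  exact ⟨U, W, le_antisymm (iSup_le hWU) fun x hx => Opens.mem_iSup.mpr ⟨⟨x, hx⟩, hxW ⟨x, hx⟩⟩, hW⟩
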